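/- **Theorem 1.1.** Let $n\ge 1$, $0<a<1$, $\mathbb R^n_+=\{x\in\mathbb R^n : x_n>0\}$ and write $\xi=(\xi',\xi_n)$, $\langle\xi\rangle=(1+|\xi|^2)^{1/2}$, $\langle\xi'\rangle=(1+|\xi'|^2)^{1/2}$. For a symbol $p$ put $\operatorname{Op}(p)u=\mathcal F^{-1}(p\,\mathcal Fu)$, $\mathcal Fu(\xi)=\int e^{-ix\cdot\xi}u(x)\,dx$, on tempered distributions, and let $$P=(1-\Delta)^a=\operatorname{Op}\big((1+|\xi|^2)^a\big),\qquad \Xi_+^{t}=\operatorname{Op}\big((\langle\xi'\rangle+i\xi_n)^t\big)\quad(t\in\mathbb R,\ \text{principal branch}).$$ For $s\in\mathbb R$ let $H^s(\mathbb R^n)=\{u\in\mathcal S'(\mathbb R^n) : \langle\xi\rangle^s\mathcal Fu\in L_2(\mathbb R^n)\}$. Let $r^+$ denote restriction of distributions to $\mathbb R^n_+$ and $e^+$ extension by zero of functions from $\mathbb R^n_+$ to $\mathbb R^n$, and put $$\overline H^s(\mathbb R^n_+)=r^+H^s(\mathbb R^n),\qquad \dot H^s(\overline{\mathbb R}^n_+)=\{u\in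 H^s(\mathbb R^n) : \operatorname{supp}u\subset\overline{\mathbb R}^n_+\}.$$ For $t\ge a$ the $a$-transmission space is $H^{a(t)}(\overline{\mathbb R}^n_+)=\Xi_+^{-a}e^+\,\overline H^{t-a}(\mathbb R^n_+)$. For every $f\in\overline H^{-a}(\mathbb R^n_+)$ the homogeneous Dirichlet problem $$r^+Pu=f\ \text{ on }\mathbb R^n_+,\qquad \operatorname{supp}u\subset\overline{\mathbb R}^n_+,$$ has a unique solution $u\in\dot H^a(\overline{\mathbb R}^n_+)$. Let $s\ge -a$. If $u\in\dot H^a(\overline{\mathbb R}^n_+)$ solves the problem with datum $f$, then $$f\in\overline H^s(\mathbb R^n_+)\iff u\in H^{a(s+2a)}(\overline{\mathbb R}^n_+).$$ Moreover $H^{a(s+2a)}(\overline{\mathbb R}^n_+)\subset\dot H^a(\overline{\mathbb R}^n_+)$, so that every element of the transmission space is such a solution, with $f=r^+Pu$. In particular (the case $s=0$), the domain $D(P_D)=\{u\in\dot H^a(\overline{\mathbb R}^n_+) : r^+Pu\in L_2(\mathbb R^n_+)\}$ of the $L_2$ Dirichlet realization $P_D$ of $P$ satisfies $D(P_D)=H^{a(2a)}(\overline{\mathbb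 R}^n_+)$. -/

import Mathlib

open MeasureTheory TopologicalSpace FourierTransform
open scoped SchwartzMap Distributions ContDiff ENNReal

noncomputable section

namespace HalfSpaceDirichlet

/-- Euclidean space of dimension `m + 1`. A point is written `x = (x', x_last)`, where `x'` collects
the first `m` coordinates and `x_last` is the coordinate with index `Fin.last m`. -/
abbrev Space (m : ℕ) : Type := EuclideanSpace ℝ (Fin (m + 1))

/-- The open half-space where the last coordinate is positive. -/
def halfSpace (m : ℕ) : Opens (Space m) :=
  ⟨{x | 0 < x (Fin.last m)},
    isOpen_lt continuous_const (EuclideanSpace.proj (𝕜 := ℝ) (Fin.last m)).continuous⟩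

/-! ### Restriction of tempered distributions to an open set -/

section Restriction

variable {E : Type*} [NormedAddCommGroup E] [NormedSpace ℝ E]

/-- A real test function on `Ω`, regarded as a complex Schwartz function on the whole space. -/
def testToSchwartz (Ω : Opens E) (φ : 𝓓(Ω, ℝ)) : 𝓢(E, ℂ) :=
  HasCompactSupport.toSchwartzMap (f := fun x => (φ x : ℂ))
    (φ.hasCompactSupport.comp_left (g := Complex.ofReal) Complex.ofReal_zero)
    (Complex.ofRealCLM.contDiff.comp φ.contDiff)

@[simp]
theorem testToSchwartz_apply (Ω : Opens E) (φ : 𝓓(Ω, ℝ)) (x : E) :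
    testToSchwartz Ω φ x = (φ x : ℂ) := rfl

theorem continuous_testToSchwartz_ofSupportedIn (Ω : Opens E) (K : Compacts E)
    (hK : (K : Set E) ⊆ Ω) :
    Continuous (testToSchwartz Ω ∘ TestFunction.ofSupportedIn (n := ⊤) (F := ℝ) hK) := by
  let L : 𝓓^{⊤}_{K}(E, ℝ) →ₗ[ℝ] 𝓢(E, ℂ) :=
    { toFun := testToSchwartz Ω ∘ TestFunction.ofSupportedIn (n := ⊤) (F := ℝ) hK
      map_add' := fun f g => by
        ext x
        exact Complex.ofReal_add _ _
      map_smul' := fun c f => by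
        ext x
        exact Complex.ofReal_mul _ _ }
  change Continuous L
  refine WithSeminorms.continuous_of_isBounded
    (ContDiffMapSupportedIn.withSeminorms ℝ E ℝ ⊤ K) (schwartz_withSeminorms ℝ E ℂ) _ ?_
  rintro ⟨k, i⟩
  obtain ⟨R, hR⟩ := K.isCompact.isBounded.exists_norm_le
  have hC : 0 ≤ max R 0 ^ k := by positivity
  refine ⟨{i}, ⟨max R 0 ^ k, hC⟩, fun f => ?_⟩
  have hb : ∀ x, ‖x‖ ^ k * ‖iteratedFDeriv ℝ i (L f) x‖ ≤
      max R 0 ^ k * ContDiffMapSupportedIn.seminorm ℝ E ℝ ⊤ K i f := by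
    intro x
    have hL : ⇑(L f) = fun y => Complex.ofRealLI (f y) := rfl
    rw [hL, show (fun y => Complex.ofRealLI (f y)) = Complex.ofRealLI ∘ f from rfl,
      LinearIsometry.norm_iteratedFDeriv_comp_left (n := ∞) Complex.ofRealLI
        f.contDiff.contDiffAt (mod_cast le_top)]
    by_cases hx : x ∈ K
    · have h1 : ‖x‖ ≤ max R 0 := (hR x hx).trans (le_max_left _ _)
      have h2 := ContDiffMapSupportedIn.norm_iteratedFDeriv_apply_le_seminorm_top ℝ
        (i := i) (f := f) (x := x)
      gcongr
    · rw [f.iteratedFDeriv_zero_on_compl hx]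
      simp only [Pi.zero_apply, norm_zero, mul_zero]
      exact mul_nonneg hC (apply_nonneg _ _)
  have h := (L f).seminorm_le_bound ℝ k i (mul_nonneg hC (apply_nonneg _ _)) hb
  rw [Finset.sup_singleton]
  exact h

/-- The inclusion of test functions on `Ω` into Schwartz functions, as a continuous linear map. -/
def testToSchwartzCLM (Ω : Opens E) : 𝓓(Ω, ℝ) →L[ℝ] 𝓢(E, ℂ) :=
  TestFunction.mkCLM ℝ (testToSchwartz Ω)
    (fun f g => by ext x; exact Complex.ofReal_add _ _)
    (fun c f => by ext x; exact Complex.ofReal_mul _ _)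
    (continuous_testToSchwartz_ofSupportedIn Ω)

/-- The restriction `r⁺ u` of a tempered distribution `u` to the open set `Ω`; it is a
distribution on `Ω`. -/
def restrict (Ω : Opens E) (u : 𝓢'(E, ℂ)) : 𝓓'(Ω, ℂ) where
  toFun φ := u (testToSchwartz Ω φ)
  map_add' φ ψ := by
    rw [show testToSchwartz Ω (φ + ψ) = testToSchwartz Ω φ + testToSchwartz Ω ψ from
      map_add (testToSchwartzCLM Ω) φ ψ, map_add]
  map_smul' c φ := by
    rw [show testToSchwartz Ω (c • φ) = (c : ℂ) • testToSchwartz Ω φ from by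
      ext x; exact Complex.ofReal_mul _ _, map_smul]
    rfl
  cont := u.cont.comp (testToSchwartzCLM Ω).cont

@[simp]
theorem restrict_apply (Ω : Opens E) (u : 𝓢'(E, ℂ)) (φ : 𝓓(Ω, ℝ)) :
    restrict Ω u φ = u (testToSchwartz Ω φ) := rfl

end Restriction

/-! ### Sobolev spaces -/

section Sobolev

variable {E : Type*} [NormedAddCommGroup E] [InnerProductSpace ℝ E] [FiniteDimensional ℝ E]
  [MeasurableSpace E] [BorelSpace E]

/-- The restricted Sobolev space of order `s` on `Ω`: all restrictions to `Ω` of elements of the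
Sobolev space of order `s` on the whole space. -/
def restrictedSobolev (Ω : Opens E) (s : ℝ) : Set 𝓓'(Ω, ℂ) :=
  restrict Ω '' {u : 𝓢'(E, ℂ) | TemperedDistribution.MemSobolev s 2 u}

/-- The supported Sobolev space of order `s`: all elements of the Sobolev space of order `s` on the
whole space that are supported in the closure of `Ω`. -/
def supportedSobolev (Ω : Opens E) (s : ℝ) : Set 𝓢'(E, ℂ) :=
  {u | TemperedDistribution.MemSobolev s 2 u ∧ Distribution.dsupport u ⊆ closure (Ω : Set E)}

/-- The distribution `f` on `Ω` is given by the function `g` in `L²(Ω)`. -/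
def IsGivenBy {Ω : Opens E} (f : 𝓓'(Ω, ℂ)) (g : Lp ℂ 2 (volume.restrict (Ω : Set E))) : Prop :=
  ∀ φ : 𝓓(Ω, ℝ), f φ = ∫ x in (Ω : Set E), φ x • g x

/-- Extension by zero `e⁺` from `L²(Ω)` to `L²` of the whole space. -/
def extendByZero (Ω : Opens E) (g : Lp ℂ 2 (volume.restrict (Ω : Set E))) :
    Lp ℂ 2 (volume : Measure E) :=
  MemLp.toLp ((Ω : Set E).indicator g)
    ((memLp_indicator_iff_restrict Ω.isOpen.measurableSet).2 (Lp.memLp g))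

/-- The operator `Op(p)`, that is `u ↦ F⁻¹ (p F u)` for the Fourier transform
`F u(ξ) = ∫ exp(-i x·ξ) u(x) dx`. Mathlib's Fourier transform at `η` is `F u(2πη)`, whence the
scaling. (The symbols used below are smooth with all derivatives of polynomial growth, so that the
operator acts on all tempered distributions.) -/
def Op (p : E → ℂ) : 𝓢'(E, ℂ) →L[ℂ] 𝓢'(E, ℂ) :=
  TemperedDistribution.fourierMultiplierCLM ℂ fun η => p ((2 * Real.pi) • η)

end Sobolev

/-! ### The model Dirichlet problem on the half-space -/

/-- `⟨ξ'⟩ = (1 + |ξ'|²)^(1/2)`, where `ξ'` consists of all coordinates of `ξ` but the last. -/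
def tangentialBracket {m : ℕ} (ξ : Space m) : ℝ :=
  Real.sqrt (1 + ∑ i : Fin m, ξ i.castSucc ^ 2)

/-- The order-reducing operator `Ξ₊^t` with symbol `(⟨ξ'⟩ + i ξ_last)^t` (principal branch). -/
def XiPlus (m : ℕ) (t : ℝ) : 𝓢'(Space m, ℂ) →L[ℂ] 𝓢'(Space m, ℂ) :=
  Op fun ξ => ((tangentialBracket ξ : ℂ) + Complex.I * (ξ (Fin.last m) : ℂ)) ^ (t : ℂ)

/-- The operator `(1 - Δ)^a`, with symbol `(1 + |ξ|²)^a`. -/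
def besselOp (m : ℕ) (a : ℝ) : 𝓢'(Space m, ℂ) →L[ℂ] 𝓢'(Space m, ℂ) :=
  Op fun ξ => (((1 + ‖ξ‖ ^ 2) ^ a : ℝ) : ℂ)

/-- `u` is the (variational) solution of the homogeneous Dirichlet problem with datum `f`: `u` is of
Sobolev order `a`, it is supported in the closed half-space, and `r⁺ (1 - Δ)^a u = f`. -/
def IsDirichletSolution {m : ℕ} (a : ℝ) (f : 𝓓'(halfSpace m, ℂ)) (u : 𝓢'(Space m, ℂ)) : Prop :=
  u ∈ supportedSobolev (halfSpace m) a ∧ restrict (halfSpace m) (besselOp m a u) = f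

/-- The `a`-transmission space of order `t`, for `t ≥ a`: the image under `Ξ₊^(-a) e⁺` of the
restricted Sobolev space of order `t - a`, whose elements are functions in `L²` of the half-space
because `t - a ≥ 0`. -/
def transmissionSpace (m : ℕ) (a t : ℝ) : Set 𝓢'(Space m, ℂ) :=
  {u | ∃ f ∈ restrictedSobolev (halfSpace m) (t - a),
    ∃ g : Lp ℂ 2 (volume.restrict (halfSpace m : Set (Space m))), IsGivenBy f g ∧
      u = XiPlus m (-a) (extendByZero (halfSpace m) g : 𝓢'(Space m, ℂ))}

/-- The domain of the `L²` Dirichlet realization of `(1 - Δ)^a` on the half-space: the elements `u`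
of the supported Sobolev space of order `a` for which `r⁺ (1 - Δ)^a u` is in `L²`. -/
def dirichletDomain (m : ℕ) (a : ℝ) : Set 𝓢'(Space m, ℂ) :=
  {u | u ∈ supportedSobolev (halfSpace m) a ∧
    ∃ g : Lp ℂ 2 (volume.restrict (halfSpace m : Set (Space m))),
      IsGivenBy (restrict (halfSpace m) (besselOp m a u)) g}

end HalfSpaceDirichlet

end

open HalfSpaceDirichlet

/-!
The proof rests on the factorization `(1 + |ξ|²)^a = (⟨ξ'⟩ + i ξ_n)^a (⟨ξ'⟩ - i ξ_n)^a`, that is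
`(1 - Δ)^a = Ξ₋^a Ξ₊^a`, and on two facts about the factors: `Ξ₊^t` preserves support in the closed
half-space, and, by duality, `r⁺ Ξ₋^t u` depends on `r⁺ u` only. Both factors shift the Sobolev order
by `t`. Hence `v = Ξ₊^a u` identifies the elements of order `a` supported in the closed half-space
with the square integrable functions supported there, which are the extensions by zero of their
restrictions, and the equation `r⁺ (1 - Δ)^a u = r⁺ F` becomes `r⁺ v = r⁺ Ξ₋^(-a) F`
(`restrict_besselOp_eq_iff`). It has exactly one solution, and `r⁺ (1 - Δ)^a u` is a restriction
from order `s` exactly if `r⁺ v` is one from order `s + a`, which is the definition of the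
transmission space.

Support preservation is proved for an arbitrary unit vector `e` and the symbol
`A = (1 + |ξ'|²)^(1/2) + i ⟨e, ξ⟩`, where `ξ'` is the part of `ξ` orthogonal to `e`; the choices
`e = e_n` and `e = -e_n` give `Ξ₊` and `Ξ₋`. The transposed operator is `φ ↦ 𝓕 (A^t 𝓕⁻ φ)`, and it
has to map Schwartz functions vanishing on `⟨e, x⟩ > c` to such functions.

* A symbol that is constant along `e` gives an operator that commutes with multiplication by
  functions of `⟨e, x⟩`, so it has this property
  (`fourier_mul_fourierInv_eq_zero_of_invariant`).
* For `t < 0` the Gamma integral writes `A^t` as a superposition over `τ > 0` of `exp (-τ A)`, which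
  is a symbol constant along `e` times that of a translation by `τ e`
  (`fourier_mul_normalSymbol_cpow_neg_eq_zero`).
* Multiplication of the symbol by `A` combines a symbol constant along `e` with the derivative along
  `e`, whence all `t` by induction (`fourier_smulLeftCLM_normalSymbol_cpow_eq_zero`).

Passing to tempered distributions uses that Schwartz functions are limits of compactly supported
ones with no larger support (`exists_seq_hasCompactSupport_tendsto`).
-/

namespace HalfSpaceDirichlet

/-! ### Complex powers of symbols of temperate growth -/

theorem norm_iteratedFDeriv_cpow_le {E : Type*} [NormedAddCommGroup E] [NormedSpace ℝ E]
    {f : E → ℂ} (hf : f.HasTemperateGrowth) (h1 : ∀ x, 1 ≤ (f x).re) (n : ℕ) :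
    ∀ t : ℝ, ContDiff ℝ n (fun x => f x ^ (t : ℂ)) ∧ ∃ (k : ℕ) (C : ℝ), 0 ≤ C ∧
      ∀ N ≤ n, ∀ x, ‖iteratedFDeriv ℝ N (fun x => f x ^ (t : ℂ)) x‖ ≤ C * (1 + ‖x‖) ^ k := by
  have hslit : ∀ x, f x ∈ Complex.slitPlane := fun x => Or.inl (by linarith [h1 x])
  have hnorm : ∀ x, 1 ≤ ‖f x‖ := fun x => (h1 x).trans (Complex.re_le_norm _)
  induction n with
  | zero =>
    intro t
    refine ⟨contDiff_zero.2 (hf.1.continuous.cpow continuous_const hslit), ?_⟩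
    obtain ⟨k, C, hC⟩ := hf.2 0
    simp only [norm_iteratedFDeriv_zero] at hC
    have hC0 : 0 ≤ C := by
      have h := (norm_nonneg _).trans (hC 0)
      simpa using h
    refine ⟨k * ⌈|t|⌉₊, C ^ ⌈|t|⌉₊, by positivity, fun N hN x => ?_⟩
    obtain rfl : N = 0 := by omega
    rw [norm_iteratedFDeriv_zero, Complex.norm_cpow_real]
    calc ‖f x‖ ^ t ≤ ‖f x‖ ^ ((⌈|t|⌉₊ : ℕ) : ℝ) :=
          Real.rpow_le_rpow_of_exponent_le (hnorm x) ((le_abs_self t).trans (Nat.le_ceil _))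
      _ = ‖f x‖ ^ ⌈|t|⌉₊ := Real.rpow_natCast _ _
      _ ≤ (C * (1 + ‖x‖) ^ k) ^ ⌈|t|⌉₊ := by gcongr; exact hC x
      _ = _ := by rw [mul_pow, pow_mul]
  | succ n ih =>
    intro t
    have hfd : ∀ x, HasFDerivAt (fun x => f x ^ (t : ℂ))
        (((t : ℂ) * f x ^ ((t - 1 : ℝ) : ℂ)) • fderiv ℝ f x) x := by
      intro x
      have h2 : HasFDerivAt f (fderiv ℝ f x) x :=
        (hf.1.differentiable (by simp) x).hasFDerivAt
      have h3 := (Complex.hasStrictDerivAt_cpow_const (c := (t : ℂ)) (hslit x)).hasDerivAt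
      have h4 := h3.comp_hasFDerivAt_of_eq x h2 rfl
      push_cast
      exact h4
    have hfderiv : fderiv ℝ (fun x => f x ^ (t : ℂ)) =
        fun x => ((t : ℂ) * f x ^ ((t - 1 : ℝ) : ℂ)) • fderiv ℝ f x :=
      funext fun x => (hfd x).fderiv
    obtain ⟨hcd, k₁, C₁, hC₁, hb₁⟩ := ih (t - 1)
    have hfg : ContDiff ℝ ∞ (fderiv ℝ f) := hf.1.fderiv_right (by simp)
    have hcd' : ContDiff ℝ n (fun x => (t : ℂ) * f x ^ ((t - 1 : ℝ) : ℂ)) :=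
      contDiff_const.mul hcd
    have hcdn : ContDiff ℝ n (fderiv ℝ f) := hfg.of_le (mod_cast le_top)
    refine ⟨?_, ?_⟩
    · push_cast
      refine contDiff_succ_iff_fderiv.2 ⟨fun x => (hfd x).differentiableAt, by simp, ?_⟩
      rw [hfderiv]
      exact hcd'.smul hcdn
    obtain ⟨k₀, C₀, hC₀, hb₀⟩ := (ih t).2
    obtain ⟨k₂, C₂, hC₂, hb₂⟩ := hf.norm_iteratedFDeriv_le_uniform (n + 1)
    refine ⟨k₀ + k₁ + k₂, C₀ + ∑ i ∈ Finset.range (n + 1), n.choose i * (|t| * C₁) * C₂,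
      by positivity, fun N hN x => ?_⟩
    have h1x : 1 ≤ 1 + ‖x‖ := by linarith [norm_nonneg x]
    rcases hN.lt_or_eq with hN | rfl
    · refine (hb₀ N (by omega) x).trans ?_
      gcongr
      · exact le_add_of_nonneg_right (by positivity)
      · omega
    rw [← norm_iteratedFDeriv_fderiv, hfderiv]
    refine (norm_iteratedFDeriv_smul_le hcd' hcdn x le_rfl).trans ?_
    have hsum : ∑ i ∈ Finset.range (n + 1), (n.choose i : ℝ) *
          ‖iteratedFDeriv ℝ i (fun x => (t : ℂ) * f x ^ ((t - 1 : ℝ) : ℂ)) x‖ *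
          ‖iteratedFDeriv ℝ (n - i) (fderiv ℝ f) x‖ ≤
        ∑ i ∈ Finset.range (n + 1), n.choose i * (|t| * C₁) * C₂ * (1 + ‖x‖) ^ (k₀ + k₁ + k₂) := by
      refine Finset.sum_le_sum fun i hi => ?_
      have hi' : i ≤ n := by simpa [Nat.lt_succ_iff] using hi
      have e1 : ‖iteratedFDeriv ℝ i (fun x => (t : ℂ) * f x ^ ((t - 1 : ℝ) : ℂ)) x‖ ≤
          |t| * (C₁ * (1 + ‖x‖) ^ k₁) := by
        have h := iteratedFDeriv_const_smul_apply' (𝕜 := ℝ) (a := (t : ℂ)) (i := i) (x := x)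
          (f := fun x => f x ^ ((t - 1 : ℝ) : ℂ))
          (hcd.of_le (by exact_mod_cast hi')).contDiffAt
        simp only [smul_eq_mul] at h
        rw [h, norm_smul, Complex.norm_real, Real.norm_eq_abs]
        gcongr
        exact hb₁ i hi' x
      have e2 : ‖iteratedFDeriv ℝ (n - i) (fderiv ℝ f) x‖ ≤ C₂ * (1 + ‖x‖) ^ k₂ := by
        rw [norm_iteratedFDeriv_fderiv]
        exact hb₂ _ (by omega) x
      calc _ ≤ (n.choose i : ℝ) * (|t| * (C₁ * (1 + ‖x‖) ^ k₁)) * (C₂ * (1 + ‖x‖) ^ k₂) := by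
            gcongr
        _ = (n.choose i : ℝ) * (|t| * C₁) * C₂ * (1 + ‖x‖) ^ (k₁ + k₂) := by
            rw [pow_add]; ring
        _ ≤ _ := by
            gcongr
            omega
    refine hsum.trans ?_
    rw [← Finset.sum_mul]
    gcongr
    exact le_add_of_nonneg_left hC₀

/-- A real power of a function of temperate growth with real part at least `1` is again of temperate
growth: the derivative of `f ^ t` is `t f ^ (t - 1)` times that of `f`, so that the bounds for all
powers follow together by induction on the order of differentiation. -/
theorem hasTemperateGrowth_cpow {E : Type*} [NormedAddCommGroup E] [NormedSpace ℝ E]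
    {f : E → ℂ} (hf : f.HasTemperateGrowth) (h1 : ∀ x, 1 ≤ (f x).re) (t : ℝ) :
    (fun x => f x ^ (t : ℂ)).HasTemperateGrowth := by
  refine ⟨contDiff_infty.2 fun n => (norm_iteratedFDeriv_cpow_le hf h1 n t).1, fun n => ?_⟩
  obtain ⟨k, C, -, h⟩ := (norm_iteratedFDeriv_cpow_le hf h1 n t).2
  exact ⟨k, C, h n le_rfl⟩

/-! ### The order-reducing symbols of a half-space -/

section Symbol

variable {E : Type*} [NormedAddCommGroup E] [InnerProductSpace ℝ E]

/-- `(1 + |ξ'|²)^(1/2)`, where `ξ'` is the component of `ξ` orthogonal to the unit vector `e`. -/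
noncomputable def normalBracket (e ξ : E) : ℝ := Real.sqrt (1 + ‖ξ - inner ℝ e ξ • e‖ ^ 2)

/-- The symbol `(1 + |ξ'|²)^(1/2) + i ⟨e, ξ⟩`; its powers are the symbols of operators that preserve
support in the half-spaces `⟨e, x⟩ ≥ c`. -/
noncomputable def normalSymbol (e ξ : E) : ℂ :=
  (normalBracket e ξ : ℂ) + Complex.I * (inner ℝ e ξ : ℂ)

theorem one_le_normalBracket (e ξ : E) : 1 ≤ normalBracket e ξ :=
  Real.one_le_sqrt.2 (le_add_of_nonneg_right (by positivity))

@[simp]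
theorem normalSymbol_re (e ξ : E) : (normalSymbol e ξ).re = normalBracket e ξ := by
  simp [normalSymbol]

theorem one_le_re_normalSymbol (e ξ : E) : 1 ≤ (normalSymbol e ξ).re := by
  simpa using one_le_normalBracket e ξ

theorem normalSymbol_ne_zero (e ξ : E) : normalSymbol e ξ ≠ 0 := by
  intro h
  have := one_le_re_normalSymbol e ξ
  rw [h] at this
  norm_num at this

theorem normalSymbol_arg_ne_pi (e ξ : E) : (normalSymbol e ξ).arg ≠ Real.pi := by
  have h : normalSymbol e ξ ∈ Complex.slitPlane := Or.inl (by linarith [one_le_re_normalSymbol e ξ])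
  exact Complex.slitPlane_arg_ne_pi h

theorem normalBracket_add_smul {e : E} (he : ‖e‖ = 1) (ξ : E) (r : ℝ) :
    normalBracket e (ξ + r • e) = normalBracket e ξ := by
  have : ξ + r • e - inner ℝ e (ξ + r • e) • e = ξ - inner ℝ e ξ • e := by
    rw [inner_add_right, real_inner_smul_right, real_inner_self_eq_norm_sq, he]
    module
  rw [normalBracket, this, normalBracket]

theorem norm_sq_normalSymbol {e : E} (he : ‖e‖ = 1) (ξ : E) :
    ‖normalSymbol e ξ‖ ^ 2 = 1 + ‖ξ‖ ^ 2 := by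
  have h1 : ‖ξ - inner ℝ e ξ • e‖ ^ 2 = ‖ξ‖ ^ 2 - inner ℝ e ξ ^ 2 := by
    rw [norm_sub_sq_real, norm_smul, he, real_inner_smul_right, real_inner_comm, mul_one,
      Real.norm_eq_abs, sq_abs]
    ring
  rw [Complex.sq_norm, Complex.normSq_apply]
  simp only [normalSymbol, Complex.add_re, Complex.ofReal_re, Complex.mul_re, Complex.I_re,
    zero_mul, Complex.I_im, Complex.ofReal_im, mul_zero, sub_self, add_zero, Complex.add_im,
    Complex.mul_im, one_mul, zero_add]
  rw [normalBracket, Real.mul_self_sqrt (by positivity), h1]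
  ring

theorem normalSymbol_neg_left (e ξ : E) :
    normalSymbol (-e) ξ = starRingEnd ℂ (normalSymbol e ξ) := by
  simp [normalSymbol, normalBracket]

theorem normalSymbol_cpow_mul_neg_left {e : E} (he : ‖e‖ = 1) (ξ : E) (a : ℝ) :
    normalSymbol e ξ ^ (a : ℂ) * normalSymbol (-e) ξ ^ (a : ℂ) =
      (((1 + ‖ξ‖ ^ 2) ^ a : ℝ) : ℂ) := by
  rw [normalSymbol_neg_left, Complex.conj_cpow _ _ (normalSymbol_arg_ne_pi e ξ),
    Complex.conj_ofReal, Complex.mul_conj, Complex.normSq_eq_norm_sq, Complex.norm_cpow_real,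
    ← norm_sq_normalSymbol he, ← Real.rpow_natCast, ← Real.rpow_natCast, ← Real.rpow_mul
    (norm_nonneg _), ← Real.rpow_mul (norm_nonneg _), mul_comm]

theorem normalSymbol_cpow_mul_cpow (e ξ : E) (s t : ℝ) :
    normalSymbol e ξ ^ (s : ℂ) * normalSymbol e ξ ^ (t : ℂ) =
      normalSymbol e ξ ^ ((s + t : ℝ) : ℂ) := by
  rw [Complex.ofReal_add, Complex.cpow_add _ _ (normalSymbol_ne_zero e ξ)]

theorem hasTemperateGrowth_normalBracket (e : E) : (normalBracket e).HasTemperateGrowth := by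
  have h : (fun ξ : E => (1 + ‖ξ‖ ^ 2) ^ (1 / 2 : ℝ)).HasTemperateGrowth := by fun_prop
  have h2 : (fun ξ : E => ξ - inner ℝ e ξ • e).HasTemperateGrowth := by fun_prop
  have h3 := h.comp h2
  have : normalBracket e = (fun ξ : E => (1 + ‖ξ‖ ^ 2) ^ (1 / 2 : ℝ)) ∘
      fun ξ : E => ξ - inner ℝ e ξ • e := by
    funext ξ
    simp [normalBracket, Real.sqrt_eq_rpow]
  rwa [this]

theorem hasTemperateGrowth_normalSymbol (e : E) : (normalSymbol e).HasTemperateGrowth := by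
  have h := hasTemperateGrowth_normalBracket e
  have h2 : (fun ξ => ((normalBracket e ξ : ℝ) : ℂ)).HasTemperateGrowth :=
    Function.Complex.hasTemperateGrowth_ofReal.comp h
  have h3 : (fun ξ : E => ((inner ℝ e ξ : ℝ) : ℂ)).HasTemperateGrowth :=
    Function.Complex.hasTemperateGrowth_ofReal.comp (Function.hasTemperateGrowth_inner_right e)
  exact h2.add ((Function.HasTemperateGrowth.const Complex.I).mul h3)

theorem hasTemperateGrowth_normalSymbol_cpow (e : E) (t : ℝ) :
    (fun ξ => normalSymbol e ξ ^ (t : ℂ)).HasTemperateGrowth :=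
  hasTemperateGrowth_cpow (hasTemperateGrowth_normalSymbol e) (one_le_re_normalSymbol e) t

/- Mathlib's Fourier transform at `η` is the one of `Op` at `2π η`, which accounts for the scaling
by `2π` below. -/

theorem hasTemperateGrowth_normalBracket_scaled (e : E) :
    (fun ξ : E => ((normalBracket e ((2 * Real.pi) • ξ) : ℝ) : ℂ)).HasTemperateGrowth :=
  Function.Complex.hasTemperateGrowth_ofReal.comp
    ((hasTemperateGrowth_normalBracket e).comp
      (g := normalBracket e) (f := fun ξ : E => (2 * Real.pi) • ξ) (by fun_prop))

theorem hasTemperateGrowth_normalSymbol_scaled_cpow (e : E) (t : ℝ) :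
    (fun ξ : E => normalSymbol e ((2 * Real.pi) • ξ) ^ (t : ℂ)).HasTemperateGrowth :=
  (hasTemperateGrowth_normalSymbol_cpow e t).comp (f := fun ξ : E => (2 * Real.pi) • ξ)
    (by fun_prop)

theorem cexp_neg_normalSymbol_mul (e ξ : E) (τ : ℝ) :
    Complex.exp (-(normalSymbol e ((2 * Real.pi) • ξ) * τ)) =
      (Real.exp (-(normalBracket e ((2 * Real.pi) • ξ) * τ)) : ℂ) *
        Real.fourierChar (-(τ * inner ℝ e ξ)) := by
  rw [Real.fourierChar_apply, Complex.ofReal_exp, ← Complex.exp_add, normalSymbol,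
    real_inner_smul_right]
  congr 1
  push_cast
  ring

theorem norm_normalSymbol_cpow_le {e : E} (he : ‖e‖ = 1) (t : ℝ) (ξ : E) :
    ‖normalSymbol e ((2 * Real.pi) • ξ) ^ (t : ℂ)‖ ≤
      ((2 * Real.pi) ^ 2) ^ (|t| / 2) * (1 + ‖ξ‖ ^ 2) ^ (t / 2) := by
  have hpos : 0 < 1 + ‖ξ‖ ^ 2 := by positivity
  have hpi : 1 ≤ (2 * Real.pi) ^ 2 := one_le_pow₀ (by linarith [Real.pi_gt_three])
  have hn : ‖normalSymbol e ((2 * Real.pi) • ξ)‖ ^ 2 = 1 + (2 * Real.pi) ^ 2 * ‖ξ‖ ^ 2 := by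
    rw [norm_sq_normalSymbol he, norm_smul, mul_pow, Real.norm_of_nonneg (by positivity)]
  have hsq : ‖normalSymbol e ((2 * Real.pi) • ξ)‖ ^ t =
      (1 + (2 * Real.pi) ^ 2 * ‖ξ‖ ^ 2) ^ (t / 2) := by
    rw [← hn, ← Real.rpow_natCast, ← Real.rpow_mul (norm_nonneg _)]
    congr 1
    push_cast
    ring
  have hpos' : 0 < 1 + (2 * Real.pi) ^ 2 * ‖ξ‖ ^ 2 := by positivity
  set q := (1 + (2 * Real.pi) ^ 2 * ‖ξ‖ ^ 2) / (1 + ‖ξ‖ ^ 2) with hq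
  have hq1 : 1 ≤ q := by
    rw [hq, one_le_div hpos]
    nlinarith [sq_nonneg ‖ξ‖]
  have hq2 : q ≤ (2 * Real.pi) ^ 2 := by
    rw [hq, div_le_iff₀ hpos]
    nlinarith [sq_nonneg ‖ξ‖]
  have hqt : q ^ (t / 2) ≤ ((2 * Real.pi) ^ 2) ^ (|t| / 2) :=
    (Real.rpow_le_rpow_of_exponent_le hq1 (by linarith [le_abs_self t])).trans
      (Real.rpow_le_rpow (by linarith) hq2 (by positivity))
  rw [Complex.norm_cpow_real, hsq, show 1 + (2 * Real.pi) ^ 2 * ‖ξ‖ ^ 2 = q * (1 + ‖ξ‖ ^ 2) by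
    rw [hq, div_mul_cancel₀ _ hpos.ne'], Real.mul_rpow (by linarith) hpos.le]
  gcongr

end Symbol

/-! ### Multipliers preserving support in half-spaces -/

section Support

variable {E : Type*} [NormedAddCommGroup E] [InnerProductSpace ℝ E] [FiniteDimensional ℝ E]
  [MeasurableSpace E] [BorelSpace E]

/-- Convolution of `𝓕⁻ φ` with a function on the line `ℝ e` amounts to multiplying `φ` by a function
of `⟨e, x⟩`. -/
theorem integral_mul_fourierInv_sub_smul (θ : 𝓢(ℝ, ℂ)) (φ : 𝓢(E, ℂ)) (e η : E) :
    ∫ r, θ r * 𝓕⁻ φ (η - r • e) =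
      ∫ y, Real.fourierChar (inner ℝ y η) • (𝓕 θ (inner ℝ e y) * φ y) := by
  have h1 : ∀ r, θ r * 𝓕⁻ φ (η - r • e) =
      ∫ y, θ r * Real.fourierChar (inner ℝ y (η - r • e)) • φ y := by
    intro r
    rw [integral_const_mul, SchwartzMap.fourierInv_coe, Real.fourierInv_eq]
  simp_rw [h1]
  have hθφ : Integrable (fun p : ℝ × E => θ p.1 * φ p.2) := θ.integrable.mul_prod φ.integrable
  rw [integral_integral_swap]
  · refine integral_congr_ae (ae_of_all _ fun y => ?_)
    simp only [SchwartzMap.fourier_coe, Real.fourier_real_eq, Circle.smul_def, smul_eq_mul]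
    rw [← integral_mul_const, ← integral_const_mul]
    refine integral_congr_ae (ae_of_all _ fun r => ?_)
    have : inner ℝ y (η - r • e) = inner ℝ y η + -(r * inner ℝ e y) := by
      rw [inner_sub_right, real_inner_smul_right, real_inner_comm y e]
      ring
    simp only [this, AddChar.map_add_eq_mul, Circle.coe_mul]
    ring
  · refine hθφ.mono ?_ (ae_of_all _ fun p => ?_)
    · refine Continuous.aestronglyMeasurable ?_
      have h1 := θ.continuous
      have h2 := φ.continuous
      have h3 := Real.continuous_fourierChar
      simp only [Function.uncurry_def]
      fun_prop
    · simp only [Function.uncurry_def, norm_mul, Circle.norm_smul, le_refl]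

/-- A Fourier multiplier whose symbol does not vary in the direction `e` preserves vanishing on
`c < ⟨e, x⟩`: it commutes with multiplication by functions of `⟨e, x⟩`, in particular by one that
is supported in `c < ⟨e, x⟩`. -/
theorem fourier_mul_fourierInv_eq_zero_of_invariant {e : E} {c : ℝ} {φ : 𝓢(E, ℂ)}
    (hφ : ∀ x, c < inner ℝ e x → φ x = 0) {w : E → ℂ} (hw : Continuous w)
    (hinv : ∀ ξ (r : ℝ), w (ξ + r • e) = w ξ)
    (hint : Integrable (fun ξ => w ξ * 𝓕⁻ φ ξ)) {x : E} (hx : c < inner ℝ e x) :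
    𝓕 (fun ξ => w ξ * 𝓕⁻ φ ξ) x = 0 := by
  -- A function `ψ` of `⟨e, ·⟩` alone equal to `1` at `x` and with `ψ (⟨e, ·⟩) φ = 0`.
  obtain ⟨ψ, hψx, hψ⟩ : ∃ ψ : 𝓢(ℝ, ℂ), ψ (inner ℝ e x) = 1 ∧ ∀ s ≤ c, ψ s = 0 := by
    let b : ContDiffBump (inner ℝ e x : ℝ) :=
      ⟨(inner ℝ e x - c) / 3, (inner ℝ e x - c) / 2, by linarith, by linarith⟩
    have hb : HasCompactSupport (fun s => (b s : ℂ)) :=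
      b.hasCompactSupport.comp_left (g := Complex.ofReal) Complex.ofReal_zero
    refine ⟨hb.toSchwartzMap (Complex.ofRealCLM.contDiff.comp b.contDiff), ?_, fun s hs => ?_⟩
    · change ((b (inner ℝ e x) : ℝ) : ℂ) = 1
      rw [b.one_of_mem_closedBall (by simpa using b.rIn_pos.le), Complex.ofReal_one]
    · change ((b s : ℝ) : ℂ) = 0
      rw [b.zero_of_le_dist, Complex.ofReal_zero]
      rw [Real.dist_eq, abs_of_neg (by linarith)]
      change (inner ℝ e x - c) / 2 ≤ _
      linarith
  set θ := 𝓕⁻ ψ with hθ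
  set k : E → ℂ := fun ξ => w ξ * 𝓕⁻ φ ξ with hk
  have hθψ : 𝓕 θ = ψ := FourierTransform.fourier_fourierInv_eq ψ
  have hconv : ∀ η, ∫ r, θ r * 𝓕⁻ φ (η - r • e) = 0 := by
    intro η
    rw [integral_mul_fourierInv_sub_smul, hθψ]
    refine integral_eq_zero_of_ae (ae_of_all _ fun y => ?_)
    rcases le_or_gt (inner ℝ e y) c with h | h
    · simp [hψ _ h]
    · simp [hφ _ h]
  have hkc : Continuous k := hw.mul (𝓕⁻ φ).continuous
  have hinv' : ∀ ξ (r : ℝ), w (ξ - r • e) = w ξ := fun ξ r => by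
    have := hinv ξ (-r)
    rwa [neg_smul, ← sub_eq_add_neg] at this
  -- Modulation by a function of `⟨e, ·⟩` is translation of the symbol along `e`, which leaves `w`
  -- unchanged.
  have htrans : ∀ r : ℝ, Real.fourierChar (-(r * inner ℝ e x)) • 𝓕 k x =
      ∫ η, Real.fourierChar (-inner ℝ η x) • k (η - r • e) := by
    intro r
    have h := integral_sub_right_eq_self (μ := (volume : Measure E))
      (fun η => Real.fourierChar (-inner ℝ (η + r • e) x) • k η) (r • e)
    simp only [sub_add_cancel] at h
    rw [h, Real.fourier_eq, Circle.smul_def, ← integral_smul]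
    refine integral_congr_ae (ae_of_all _ fun η => ?_)
    have : -inner ℝ (η + r • e) x = -(r * inner ℝ e x) + -inner ℝ η x := by
      rw [inner_add_left, real_inner_smul_left]
      ring
    simp only [this, AddChar.map_add_eq_mul, Circle.smul_def, Circle.coe_mul, smul_eq_mul]
    ring
  have hfub : Integrable (Function.uncurry fun (r : ℝ) (η : E) =>
      θ r * Real.fourierChar (-inner ℝ η x) • k (η - r • e)) (volume.prod volume) := by
    rw [integrable_prod_iff]
    · have hn : ∀ r : ℝ, Integrable (fun η => ‖k (η - r • e)‖) := fun r =>
        (hint.comp_sub_right (r • e)).norm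
      refine ⟨ae_of_all _ fun r => ?_, ?_⟩
      · simp only [Function.uncurry_def]
        refine Integrable.const_mul ?_ _
        refine (hint.comp_sub_right (r • e)).mono ?_ (ae_of_all _ fun η => ?_)
        · refine Continuous.aestronglyMeasurable ?_
          have h3 := Real.continuous_fourierChar
          fun_prop
        · rw [Circle.norm_smul]
      · simp only [Function.uncurry_def, norm_mul, Circle.norm_smul]
        simp_rw [integral_const_mul, integral_sub_right_eq_self (fun η => ‖k η‖)]
        exact θ.integrable.norm.mul_const _
    · refine Continuous.aestronglyMeasurable ?_
      have h1 := θ.continuous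
      have h3 := Real.continuous_fourierChar
      simp only [Function.uncurry_def]
      fun_prop
  calc 𝓕 k x = 𝓕 θ (inner ℝ e x) * 𝓕 k x := by rw [hθψ, hψx, one_mul]
    _ = ∫ r : ℝ, θ r * Real.fourierChar (-(r * inner ℝ e x)) • 𝓕 k x := by
      rw [SchwartzMap.fourier_coe, Real.fourier_real_eq, ← integral_mul_const]
      refine integral_congr_ae (ae_of_all _ fun r => ?_)
      simp only [Circle.smul_def, smul_eq_mul]
      ring
    _ = ∫ r : ℝ, ∫ η, θ r * Real.fourierChar (-inner ℝ η x) • k (η - r • e) := by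
      simp_rw [htrans, integral_const_mul]
    _ = ∫ η, ∫ r : ℝ, θ r * Real.fourierChar (-inner ℝ η x) • k (η - r • e) :=
      integral_integral_swap hfub
    _ = ∫ η, (Real.fourierChar (-inner ℝ η x) * w η) * ∫ r, θ r * 𝓕⁻ φ (η - r • e) := by
      refine integral_congr_ae (ae_of_all _ fun η => ?_)
      simp only
      rw [← integral_const_mul]
      refine integral_congr_ae (ae_of_all _ fun r => ?_)
      simp only [hk, hinv', Circle.smul_def, smul_eq_mul]
      ring
    _ = 0 := by simp [hconv]

/-- The formula `z ^ (-s) Γ(s) = ∫₀^∞ τ ^ (s - 1) exp (-z τ) dτ` in the right half-plane. -/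
theorem integral_rpow_mul_cexp_neg_mul {s : ℝ} (hs : 0 < s) {z : ℂ} (hz : 0 < z.re) :
    ∫ τ in Set.Ioi (0 : ℝ), ((τ ^ (s - 1) : ℝ) : ℂ) * Complex.exp (-(z * τ)) =
      z ^ (-s : ℂ) * Complex.Gamma s := by
  let G : ℂ → ℂ := fun z => ∫ τ in Set.Ioi (0 : ℝ), ((τ ^ (s - 1) : ℝ) : ℂ) *
    Complex.exp (-(z * τ))
  have hopen : IsOpen {z : ℂ | 0 < z.re} := isOpen_lt continuous_const Complex.continuous_re
  have hmeas : ∀ z : ℂ, AEStronglyMeasurable (fun τ : ℝ => ((τ ^ (s - 1) : ℝ) : ℂ) *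
      Complex.exp (-(z * τ))) (volume.restrict (Set.Ioi 0)) := fun z => by
    refine AEStronglyMeasurable.mul ?_ ?_
    · refine (Measurable.aestronglyMeasurable ?_)
      fun_prop
    · exact Continuous.aestronglyMeasurable (by fun_prop)
  have hG : DifferentiableOn ℂ G {z : ℂ | 0 < z.re} := by
    intro z hz
    have hz' : 0 < z.re := hz
    have hI : ∀ q : ℝ, -1 < q → IntegrableOn (fun τ : ℝ => τ ^ q * Real.exp (-(z.re / 2) * τ))
        (Set.Ioi 0) := fun q hq => by
      have := integrableOn_rpow_mul_exp_neg_mul_rpow hq (one_pos : (0 : ℝ) < 1) (b := z.re / 2)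
        (by linarith)
      simpa using this
    have hder := hasDerivAt_integral_of_dominated_loc_of_deriv_le
      (μ := volume.restrict (Set.Ioi (0 : ℝ)))
      (F := fun (z : ℂ) (τ : ℝ) => ((τ ^ (s - 1) : ℝ) : ℂ) * Complex.exp (-(z * τ)))
      (F' := fun (z : ℂ) (τ : ℝ) => ((τ ^ (s - 1) : ℝ) : ℂ) * (Complex.exp (-(z * τ)) * -τ))
      (x₀ := z) (s := Metric.ball z (z.re / 2))
      (bound := fun τ => τ ^ s * Real.exp (-(z.re / 2) * τ))
      (Metric.ball_mem_nhds z (by linarith)) (Filter.Eventually.of_forall hmeas) ?_ ?_ ?_ ?_ ?_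
    · exact hder.2.differentiableAt.differentiableWithinAt
    · refine (hI (s - 1) (by linarith)).mono' (hmeas z) ?_
      filter_upwards [ae_restrict_mem measurableSet_Ioi] with τ hτ
      have hτ' : 0 < τ := hτ
      rw [norm_mul, Complex.norm_real, Complex.norm_exp, Real.norm_of_nonneg (by positivity)]
      gcongr
      simp
      nlinarith
    · simp_rw [← mul_assoc]
      exact (hmeas z).mul (Continuous.aestronglyMeasurable (by fun_prop))
    · filter_upwards [ae_restrict_mem measurableSet_Ioi] with τ hτ y hy
      have hτ' : 0 < τ := hτ
      have hy' : z.re / 2 ≤ y.re := by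
        have h1 : |(y - z).re| ≤ ‖y - z‖ := Complex.abs_re_le_norm _
        have h2 : ‖y - z‖ < z.re / 2 := by simpa [dist_eq_norm] using hy
        rw [Complex.sub_re] at h1
        linarith [neg_abs_le (y.re - z.re)]
      rw [norm_mul, norm_mul, Complex.norm_real, Complex.norm_exp, norm_neg, Complex.norm_real,
        Real.norm_of_nonneg (by positivity), Real.norm_of_nonneg hτ'.le]
      have h3 : τ ^ s = τ ^ (s - 1) * τ := by
        rw [Real.rpow_sub_one hτ'.ne']
        field_simp
      have h4 : (-(y * (τ : ℂ))).re ≤ -(z.re / 2) * τ := by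
        simp
        nlinarith
      rw [h3]
      calc _ ≤ τ ^ (s - 1) * (Real.exp (-(z.re / 2) * τ) * τ) := by gcongr
        _ = _ := by ring
    · exact hI s (by linarith)
    · filter_upwards with τ y hy
      have h1 : HasDerivAt (fun y : ℂ => -(y * (τ : ℂ))) (-(1 * (τ : ℂ))) y :=
        ((hasDerivAt_id y).mul_const (τ : ℂ)).neg
      rw [one_mul] at h1
      exact h1.cexp.const_mul _
  have hR : DifferentiableOn ℂ (fun z : ℂ => z ^ (-s : ℂ) * Complex.Gamma s)
      {z : ℂ | 0 < z.re} := fun z hz =>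
    (((hasStrictDerivAt_id z).cpow_const (c := (-s : ℂ))
      (Or.inl hz)).hasDerivAt.differentiableAt.mul_const _).differentiableWithinAt
  -- Both sides are holomorphic, and they agree for real `z`.
  have hreal : ∀ r : ℝ, 0 < r → G r = (r : ℂ) ^ (-s : ℂ) * Complex.Gamma s := by
    intro r hr
    have h := Complex.integral_cpow_mul_exp_neg_mul_Ioi (a := (s : ℂ)) (by simpa using hs) hr
    rw [one_div, Complex.inv_cpow _ _ (by rw [Complex.arg_ofReal_of_nonneg hr.le]; exact
      Real.pi_pos.ne), ← Complex.cpow_neg] at h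
    rw [← h]
    refine setIntegral_congr_fun measurableSet_Ioi fun τ hτ => ?_
    have hτ' : 0 < τ := hτ
    simp only [Complex.ofReal_cpow hτ'.le, Complex.ofReal_sub, Complex.ofReal_one]
  have hpre : IsPreconnected {z : ℂ | 0 < z.re} :=
    (convex_halfSpace_re_gt 0).isPreconnected
  refine (hG.analyticOnNhd hopen).eqOn_of_preconnected_of_frequently_eq (hR.analyticOnNhd hopen)
    hpre (z₀ := 1) (by simp) ?_ hz
  have ht : Filter.Tendsto (fun n : ℕ => ((1 + 1 / ((n : ℝ) + 1) : ℝ) : ℂ)) Filter.atTop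
      (nhdsWithin 1 {1}ᶜ) := by
    refine tendsto_nhdsWithin_iff.2 ⟨?_, Filter.Eventually.of_forall fun n => ?_⟩
    · have h := (tendsto_one_div_add_atTop_nhds_zero_nat (𝕜 := ℝ)).const_add 1
      rw [add_zero] at h
      exact (Complex.continuous_ofReal.tendsto' 1 1 Complex.ofReal_one).comp h
    · have : (0 : ℝ) < 1 / ((n : ℝ) + 1) := by positivity
      simp only [Set.mem_compl_iff, Set.mem_singleton_iff, Complex.ofReal_eq_one]
      linarith
  exact ht.frequently (Filter.Frequently.of_forall fun n => hreal _ (by positivity))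

/-- Negative powers: by the Gamma integral the operator is a superposition of translations by
`τ e`, `τ > 0`, composed with multipliers whose symbols do not vary in the direction `e`. -/
theorem fourier_mul_normalSymbol_cpow_neg_eq_zero {e : E} (he : ‖e‖ = 1) {c : ℝ} {φ : 𝓢(E, ℂ)}
    (hφ : ∀ x, c < inner ℝ e x → φ x = 0) {w : E → ℂ} (hw : Continuous w)
    (hinv : ∀ ξ (r : ℝ), w (ξ + r • e) = w ξ) (hint : Integrable (fun ξ => w ξ * 𝓕⁻ φ ξ))
    {s : ℝ} (hs : 0 < s) {x : E} (hx : c < inner ℝ e x) :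
    𝓕 (fun ξ => w ξ * normalSymbol e ((2 * Real.pi) • ξ) ^ (-s : ℂ) * 𝓕⁻ φ ξ) x = 0 := by
  set k : E → ℂ := fun ξ => w ξ * 𝓕⁻ φ ξ with hk
  have hkc : Continuous k := hw.mul (𝓕⁻ φ).continuous
  have hb : Continuous fun ξ : E => normalBracket e ((2 * Real.pi) • ξ) :=
    (hasTemperateGrowth_normalBracket e).1.continuous.comp (by fun_prop)
  have hA : Continuous fun ξ : E => normalSymbol e ((2 * Real.pi) • ξ) :=
    (hasTemperateGrowth_normalSymbol e).1.continuous.comp (by fun_prop)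
  have hGamma : Complex.Gamma s ≠ 0 := by
    rw [Complex.Gamma_ofReal]
    exact_mod_cast (Real.Gamma_pos_of_pos hs).ne'
  have hinner : ∀ τ ∈ Set.Ioi (0 : ℝ), ∫ ξ, ((τ ^ (s - 1) : ℝ) : ℂ) *
      (Real.fourierChar (-inner ℝ ξ x) •
        (k ξ * Complex.exp (-(normalSymbol e ((2 * Real.pi) • ξ) * τ)))) = 0 := by
    intro τ hτ
    have hτ' : 0 < τ := hτ
    rw [integral_const_mul]
    refine mul_eq_zero_of_right _ ?_
    have hwe : Continuous fun ξ : E => w ξ *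
        (Real.exp (-(normalBracket e ((2 * Real.pi) • ξ) * τ)) : ℂ) :=
      hw.mul (Complex.continuous_ofReal.comp (by fun_prop))
    have h := fourier_mul_fourierInv_eq_zero_of_invariant (x := x + τ • e) hφ hwe
      (fun ξ r => by rw [hinv, smul_add, smul_smul, normalBracket_add_smul he]) ?_ ?_
    · rw [Real.fourier_eq] at h
      rw [← h]
      refine integral_congr_ae (ae_of_all _ fun ξ => ?_)
      have : -inner ℝ ξ (x + τ • e) = -inner ℝ ξ x + -(τ * inner ℝ e ξ) := by
        rw [inner_add_right, real_inner_smul_right, real_inner_comm ξ e]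
        ring
      simp only [this, hk, cexp_neg_normalSymbol_mul, AddChar.map_add_eq_mul, Circle.smul_def,
        smul_eq_mul, Circle.coe_mul]
      ring
    · refine hint.mono (hwe.mul (𝓕⁻ φ).continuous).aestronglyMeasurable (ae_of_all _ fun ξ => ?_)
      rw [mul_right_comm, norm_mul, Complex.norm_real, Real.norm_of_nonneg (Real.exp_nonneg _)]
      refine mul_le_of_le_one_right (norm_nonneg _) (Real.exp_le_one_iff.2 ?_)
      have := one_le_normalBracket e ((2 * Real.pi) • ξ)
      nlinarith
    · rw [inner_add_right, real_inner_smul_right, real_inner_self_eq_norm_sq, he]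
      nlinarith
  have hfub : Integrable (Function.uncurry fun (ξ : E) (τ : ℝ) => ((τ ^ (s - 1) : ℝ) : ℂ) *
      (Real.fourierChar (-inner ℝ ξ x) •
        (k ξ * Complex.exp (-(normalSymbol e ((2 * Real.pi) • ξ) * τ)))))
      (volume.prod (volume.restrict (Set.Ioi (0 : ℝ)))) := by
    have hI : IntegrableOn (fun τ : ℝ => τ ^ (s - 1) * Real.exp (-τ)) (Set.Ioi 0) := by
      have := integrableOn_rpow_mul_exp_neg_mul_rpow (s := s - 1) (b := 1) (by linarith)
        (one_pos : (0 : ℝ) < 1) one_pos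
      simpa using this
    have hprod := hint.norm.mul_prod hI
    refine hprod.mono' ?_ ?_
    · simp only [Function.uncurry_def]
      refine AEStronglyMeasurable.mul ?_ ?_
      · exact (Measurable.aestronglyMeasurable (by fun_prop))
      · refine Continuous.aestronglyMeasurable ?_
        have h3 := Real.continuous_fourierChar
        have h4 := hA.comp (continuous_fst (Y := ℝ))
        simp only [Function.comp_def] at h4
        fun_prop
    · have hmem : ∀ᵐ p : E × ℝ ∂(volume.prod (volume.restrict (Set.Ioi (0 : ℝ)))), 0 < p.2 :=
        Measure.quasiMeasurePreserving_snd.ae (ae_restrict_mem measurableSet_Ioi)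
      filter_upwards [hmem] with p hp
      simp only [Function.uncurry_def, norm_mul, Circle.norm_smul, Complex.norm_real,
        Complex.norm_exp]
      rw [Real.norm_of_nonneg (by positivity : 0 ≤ p.2 ^ (s - 1))]
      have h4 : (-(normalSymbol e ((2 * Real.pi) • p.1) * (p.2 : ℂ))).re ≤ -p.2 := by
        have := one_le_normalBracket e ((2 * Real.pi) • p.1)
        simp
        nlinarith
      calc _ ≤ p.2 ^ (s - 1) * (‖k p.1‖ * Real.exp (-p.2)) := by gcongr
        _ = _ := by ring
  refine (mul_eq_zero_iff_right hGamma).1 ?_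
  rw [Real.fourier_eq]
  calc _ = ∫ ξ, ∫ τ in Set.Ioi (0 : ℝ), ((τ ^ (s - 1) : ℝ) : ℂ) *
        (Real.fourierChar (-inner ℝ ξ x) •
          (k ξ * Complex.exp (-(normalSymbol e ((2 * Real.pi) • ξ) * τ)))) := by
        rw [← integral_mul_const]
        refine integral_congr_ae (ae_of_all _ fun ξ => ?_)
        have hz : 0 < (normalSymbol e ((2 * Real.pi) • ξ)).re :=
          one_pos.trans_le (one_le_re_normalSymbol _ _)
        have h := integral_rpow_mul_cexp_neg_mul hs hz
        have h2 : ∀ τ : ℝ, ((τ ^ (s - 1) : ℝ) : ℂ) * (Real.fourierChar (-inner ℝ ξ x) •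
              (k ξ * Complex.exp (-(normalSymbol e ((2 * Real.pi) • ξ) * τ)))) =
            (Real.fourierChar (-inner ℝ ξ x) * k ξ) * (((τ ^ (s - 1) : ℝ) : ℂ) *
              Complex.exp (-(normalSymbol e ((2 * Real.pi) • ξ) * τ))) := fun τ => by
          rw [Circle.smul_def, smul_eq_mul]
          ring
        simp only [h2]
        rw [integral_const_mul, h]
        simp only [hk, Circle.smul_def, smul_eq_mul]
        ring
    _ = ∫ τ in Set.Ioi (0 : ℝ), ∫ ξ, ((τ ^ (s - 1) : ℝ) : ℂ) *
        (Real.fourierChar (-inner ℝ ξ x) •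
          (k ξ * Complex.exp (-(normalSymbol e ((2 * Real.pi) • ξ) * τ)))) :=
      integral_integral_swap hfub
    _ = 0 := by
      rw [setIntegral_congr_fun measurableSet_Ioi hinner]
      simp

/-- All real powers: multiplication by the symbol itself is a combination of a multiplier whose
symbol does not vary in the direction `e` and of the derivative along `e`, so the negative powers
suffice. -/
theorem fourier_smulLeftCLM_mul_normalSymbol_cpow_eq_zero {e : E} (he : ‖e‖ = 1) {c : ℝ} {x : E}
    (hx : c < inner ℝ e x) (n : ℕ) : ∀ (t : ℝ), t < n → ∀ {φ : 𝓢(E, ℂ)},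
    (∀ x, c < inner ℝ e x → φ x = 0) → ∀ {w : E → ℂ}, w.HasTemperateGrowth →
    (∀ ξ (r : ℝ), w (ξ + r • e) = w ξ) →
    𝓕 (SchwartzMap.smulLeftCLM ℂ
      (fun ξ => w ξ * normalSymbol e ((2 * Real.pi) • ξ) ^ (t : ℂ)) (𝓕⁻ φ)) x = 0 := by
  induction n with
  | zero =>
    intro t ht φ hφ w hw hinv
    have h := fourier_mul_normalSymbol_cpow_neg_eq_zero he hφ hw.1.continuous hinv ?_
      (s := -t) (by simpa using ht) hx
    · rw [SchwartzMap.fourier_coe]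
      refine (congrArg (fun g : E → ℂ => 𝓕 g x) (funext fun ξ => ?_)).trans h
      rw [SchwartzMap.smulLeftCLM_apply_apply
        (hw.fun_mul (hasTemperateGrowth_normalSymbol_scaled_cpow e t))]
      simp
    · have := (SchwartzMap.smulLeftCLM ℂ w (𝓕⁻ φ)).integrable (μ := volume)
      refine this.congr (ae_of_all _ fun ξ => ?_)
      simp [SchwartzMap.smulLeftCLM_apply_apply hw]
  | succ n ih =>
    intro t ht φ hφ w hw hinv
    have ht' : t - 1 < n := by push_cast at ht; linarith
    have hb := hasTemperateGrowth_normalBracket_scaled e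
    have hA := hasTemperateGrowth_normalSymbol_scaled_cpow e (t - 1)
    have hdφ : ∀ x, c < inner ℝ e x → (LineDeriv.lineDerivOp e φ) x = 0 := by
      intro y hy
      have hev : (φ : E → ℂ) =ᶠ[nhds y] fun _ => 0 := by
        have hopen : IsOpen {z : E | c < inner ℝ e z} := isOpen_lt continuous_const (by fun_prop)
        filter_upwards [hopen.mem_nhds hy] with z hz using hφ z hz
      rw [SchwartzMap.lineDerivOp_apply_eq_fderiv, hev.fderiv_eq]
      simp
    have h1 := ih (t - 1) ht' hφ (hw.fun_mul hb) fun ξ r => by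
      rw [hinv, smul_add, smul_smul, normalBracket_add_smul he]
    have h2 := ih (t - 1) ht' hdφ hw hinv
    have hL : (fun ξ : E => (inner ℝ ξ e : ℝ)).HasTemperateGrowth := by fun_prop
    have hsplit : SchwartzMap.smulLeftCLM ℂ
          (fun ξ => w ξ * normalSymbol e ((2 * Real.pi) • ξ) ^ (t : ℂ)) (𝓕⁻ φ) =
        SchwartzMap.smulLeftCLM ℂ (fun ξ => w ξ * ((normalBracket e ((2 * Real.pi) • ξ) : ℝ) : ℂ) *
            normalSymbol e ((2 * Real.pi) • ξ) ^ ((t - 1 : ℝ) : ℂ)) (𝓕⁻ φ) -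
        SchwartzMap.smulLeftCLM ℂ (fun ξ => w ξ *
            normalSymbol e ((2 * Real.pi) • ξ) ^ ((t - 1 : ℝ) : ℂ))
          (𝓕⁻ (LineDeriv.lineDerivOp e φ)) := by
      ext ξ
      rw [_root_.sub_apply, SchwartzMap.smulLeftCLM_apply_apply (hw.fun_mul
        (hasTemperateGrowth_normalSymbol_scaled_cpow e t)), SchwartzMap.smulLeftCLM_apply_apply
        ((hw.fun_mul hb).fun_mul hA), SchwartzMap.smulLeftCLM_apply_apply (hw.fun_mul hA),
        SchwartzMap.fourierInv_lineDerivOp_eq, _root_.smul_apply,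
        SchwartzMap.smulLeftCLM_apply_apply hL]
      have hpow : normalSymbol e ((2 * Real.pi) • ξ) ^ (t : ℂ) =
          normalSymbol e ((2 * Real.pi) • ξ) ^ ((t - 1 : ℝ) : ℂ) *
            normalSymbol e ((2 * Real.pi) • ξ) := by
        rw [Complex.ofReal_sub, Complex.ofReal_one,
          Complex.cpow_sub _ _ (normalSymbol_ne_zero _ _), Complex.cpow_one,
          div_mul_cancel₀ _ (normalSymbol_ne_zero _ _)]
      rw [hpow]
      have hA1 : normalSymbol e ((2 * Real.pi) • ξ) =
          (normalBracket e ((2 * Real.pi) • ξ) : ℂ) + 2 * Real.pi * Complex.I * inner ℝ ξ e := by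
        rw [normalSymbol, real_inner_smul_right, real_inner_comm]
        push_cast
        ring
      nth_rewrite 2 [hA1]
      simp only [smul_eq_mul, Complex.real_smul]
      ring
    rw [hsplit, sub_eq_add_neg, FourierTransform.fourier_add, _root_.add_apply, h1, zero_add,
      FourierTransform.fourier_neg, _root_.neg_apply, h2, neg_zero]

theorem fourier_smulLeftCLM_normalSymbol_cpow_eq_zero {e : E} (he : ‖e‖ = 1) {c : ℝ} {φ : 𝓢(E, ℂ)}
    (hφ : ∀ x, c < inner ℝ e x → φ x = 0) (t : ℝ) {x : E} (hx : c < inner ℝ e x) :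
    𝓕 (SchwartzMap.smulLeftCLM ℂ
      (fun ξ => normalSymbol e ((2 * Real.pi) • ξ) ^ (t : ℂ)) (𝓕⁻ φ)) x = 0 := by
  obtain ⟨n, hn⟩ := exists_nat_gt t
  simpa using fourier_smulLeftCLM_mul_normalSymbol_cpow_eq_zero he hx n t hn hφ
    (w := fun _ => 1) (Function.HasTemperateGrowth.const 1) (fun _ _ => rfl)

end Support

/-! ### Vanishing of tempered distributions on open sets -/

section Cutoff

variable {E : Type*} [NormedAddCommGroup E] [InnerProductSpace ℝ E]

/-- If `g` has temperate growth and vanishes on the unit ball, then `g (ε ·) φ → 0` as `ε → 0`. -/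
theorem tendsto_smulLeftCLM_comp_smul_zero {g : E → ℂ} (hg : g.HasTemperateGrowth)
    (hg0 : ∀ x, ‖x‖ < 1 → g x = 0) (φ : 𝓢(E, ℂ)) :
    Filter.Tendsto (fun n : ℕ =>
      SchwartzMap.smulLeftCLM ℂ (fun x => g ((1 / ((n : ℝ) + 1)) • x)) φ) Filter.atTop (nhds 0) := by
  rw [(schwartz_withSeminorms ℝ E ℂ).tendsto_nhds]
  rintro ⟨k, i⟩ δ hδ
  obtain ⟨l, C, hC, hb⟩ := hg.norm_iteratedFDeriv_le_uniform i
  -- All derivatives of `g` vanish on the unit ball, which gains a factor `‖x‖`.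
  have hb' : ∀ N ≤ i, ∀ x, ‖iteratedFDeriv ℝ N g x‖ ≤ C * ‖x‖ * (1 + ‖x‖) ^ l := by
    intro N hN x
    rcases lt_or_ge ‖x‖ 1 with hx | hx
    · have hev : g =ᶠ[nhds x] fun _ => 0 := by
        filter_upwards [(isOpen_lt continuous_norm continuous_const).mem_nhds hx] with z hz
          using hg0 z hz
      have h0 : iteratedFDeriv ℝ N g x = 0 := by
        rw [(hev.iteratedFDeriv ℝ N).self_of_nhds]
        simp
      rw [h0, norm_zero]
      positivity
    · refine (hb N hN x).trans ?_
      gcongr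
      exact le_mul_of_one_le_right hC hx
  set S : ℝ := ((Finset.Iic (k + (1 + l), i)).sup
    fun m : ℕ × ℕ => SchwartzMap.seminorm ℝ m.1 m.2) φ with hS
  have hS0 : 0 ≤ S := apply_nonneg _ _
  set M : ℝ := ∑ j ∈ Finset.range (i + 1), (i.choose j : ℝ) * C * (2 ^ (k + (1 + l)) * S) with hM
  have hM0 : 0 ≤ M := by positivity
  have hbound : ∀ n : ℕ, schwartzSeminormFamily ℝ E ℂ (k, i) (SchwartzMap.smulLeftCLM ℂ
      (fun x => g ((1 / ((n : ℝ) + 1)) • x)) φ - 0) ≤ 1 / ((n : ℝ) + 1) * M := by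
    intro n
    set ε : ℝ := 1 / ((n : ℝ) + 1) with hε
    have hε0 : 0 < ε := by positivity
    have hε1 : ε ≤ 1 := by
      rw [hε, div_le_one (by positivity)]
      linarith [(Nat.cast_nonneg n : (0 : ℝ) ≤ n)]
    have hgε : (fun x => g (ε • x)).HasTemperateGrowth :=
      hg.comp (f := fun x : E => ε • x) (by fun_prop)
    rw [sub_zero]
    refine SchwartzMap.seminorm_le_bound ℝ k i _ (by positivity) fun x => ?_
    have hfun : ⇑(SchwartzMap.smulLeftCLM ℂ (fun x => g (ε • x)) φ) =
        fun x => g (ε • x) * φ x := by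
      funext x
      rw [SchwartzMap.smulLeftCLM_apply_apply hgε, smul_eq_mul]
    rw [hfun]
    have hL := norm_iteratedFDeriv_mul_le (hgε.1.of_le (by exact_mod_cast le_top) :
      ContDiff ℝ i (fun x => g (ε • x))) (φ.smooth i) x le_rfl
    refine (mul_le_mul_of_nonneg_left hL (by positivity)).trans ?_
    rw [hM, Finset.mul_sum, Finset.mul_sum]
    refine Finset.sum_le_sum fun j hj => ?_
    have hj' : j ≤ i := by simpa [Nat.lt_succ_iff] using hj
    have e1 : ‖iteratedFDeriv ℝ j (fun x => g (ε • x)) x‖ ≤ ε * (C * (1 + ‖x‖) ^ (1 + l)) := by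
      have h := congrFun (iteratedFDeriv_comp_const_smul (𝕜 := ℝ) (i := j) (f := g) ε
        (hg.1.of_le (by exact_mod_cast le_top))) x
      rw [h, norm_smul, norm_pow, Real.norm_of_nonneg hε0.le]
      have h1 := hb' j hj' (ε • x)
      rw [norm_smul, Real.norm_of_nonneg hε0.le] at h1
      have h2 : ε * ‖x‖ ≤ ‖x‖ := mul_le_of_le_one_left (norm_nonneg _) hε1
      calc _ ≤ 1 * (C * (ε * ‖x‖) * (1 + ε * ‖x‖) ^ l) := by
            gcongr
            exact pow_le_one₀ hε0.le hε1
        _ ≤ 1 * (C * (ε * (1 + ‖x‖)) * (1 + ‖x‖) ^ l) := by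
            gcongr
            linarith
        _ = _ := by rw [pow_add]; ring
    have e2 : (1 + ‖x‖) ^ (k + (1 + l)) * ‖iteratedFDeriv ℝ (i - j) φ x‖ ≤
        2 ^ (k + (1 + l)) * S :=
      SchwartzMap.one_add_le_sup_seminorm_apply (𝕜 := ℝ) (m := (k + (1 + l), i)) le_rfl
        (Nat.sub_le i j) φ x
    calc _ ≤ (1 + ‖x‖) ^ k * ((i.choose j : ℝ) * (ε * (C * (1 + ‖x‖) ^ (1 + l))) *
          ‖iteratedFDeriv ℝ (i - j) φ x‖) := by
          gcongr
          linarith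
      _ = ε * ((i.choose j : ℝ) * C *
          ((1 + ‖x‖) ^ (k + (1 + l)) * ‖iteratedFDeriv ℝ (i - j) φ x‖)) := by
          rw [pow_add]; ring
      _ ≤ _ := by gcongr
  have hlim : Filter.Tendsto (fun n : ℕ => 1 / ((n : ℝ) + 1) * M) Filter.atTop (nhds 0) := by
    simpa using tendsto_one_div_add_atTop_nhds_zero_nat.mul_const M
  filter_upwards [hlim.eventually (gt_mem_nhds hδ)] with n hn using (hbound n).trans_lt hn

/-- Every Schwartz function is the limit of compactly supported ones with no larger support. -/
theorem exists_seq_hasCompactSupport_tendsto [FiniteDimensional ℝ E] (φ : 𝓢(E, ℂ)) :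
    ∃ u : ℕ → 𝓢(E, ℂ), (∀ n, HasCompactSupport (u n) ∧ tsupport (u n) ⊆ tsupport φ) ∧
      Filter.Tendsto u Filter.atTop (nhds φ) := by
  let b : ContDiffBump (0 : E) := ⟨1, 2, one_pos, by norm_num⟩
  have hbs : HasCompactSupport (fun x => (b x : ℂ)) :=
    b.hasCompactSupport.comp_left (g := Complex.ofReal) Complex.ofReal_zero
  have hbg : (fun x => (b x : ℂ)).HasTemperateGrowth :=
    hbs.hasTemperateGrowth (Complex.ofRealCLM.contDiff.comp b.contDiff)
  have hg : (fun x => (b x : ℂ) - 1).HasTemperateGrowth :=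
    hbg.fun_sub (Function.HasTemperateGrowth.const 1)
  have hlim := tendsto_smulLeftCLM_comp_smul_zero hg (fun x hx => by
    rw [b.one_of_mem_closedBall (by simpa using hx.le)]
    simp) φ
  have hscale : ∀ n : ℕ, (fun x : E => (b ((1 / ((n : ℝ) + 1)) • x) : ℂ)).HasTemperateGrowth :=
    fun n => hbg.comp (f := fun x : E => (1 / ((n : ℝ) + 1)) • x) (by fun_prop)
  refine ⟨fun n => SchwartzMap.smulLeftCLM ℂ (fun x => (b ((1 / ((n : ℝ) + 1)) • x) : ℂ)) φ,
    fun n => ⟨?_, (SchwartzMap.tsupport_smulLeftCLM_subset _ _).trans Set.inter_subset_left⟩, ?_⟩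
  · have hn : (1 / ((n : ℝ) + 1)) ≠ 0 := by positivity
    have hc : HasCompactSupport (fun x : E => (b ((1 / ((n : ℝ) + 1)) • x) : ℂ)) :=
      hbs.comp_homeomorph (Homeomorph.smulOfNeZero _ hn)
    exact hc.mono' ((subset_tsupport _).trans
      ((SchwartzMap.tsupport_smulLeftCLM_subset _ _).trans Set.inter_subset_right))
  · have h := hlim.add_const φ
    rw [zero_add] at h
    refine h.congr fun n => ?_
    ext x
    rw [_root_.add_apply, SchwartzMap.smulLeftCLM_apply_apply
      ((hscale n).fun_sub (Function.HasTemperateGrowth.const 1)),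
      SchwartzMap.smulLeftCLM_apply_apply (hscale n)]
    simp only [smul_eq_mul]
    ring

theorem isVanishingOn_of_forall_hasCompactSupport [FiniteDimensional ℝ E] {u : 𝓢'(E, ℂ)}
    {s : Set E} (h : ∀ φ : 𝓢(E, ℂ), HasCompactSupport φ → tsupport φ ⊆ s → u φ = 0) :
    Distribution.IsVanishingOn u s := by
  intro φ hφ
  obtain ⟨v, hv, hlim⟩ := exists_seq_hasCompactSupport_tendsto φ
  have h1 := (u.cont.tendsto φ).comp hlim
  have h2 : (u ∘ v : ℕ → ℂ) = fun _ => 0 := funext fun n => h _ (hv n).1 ((hv n).2.trans hφ)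
  exact tendsto_nhds_unique h1 (h2 ▸ tendsto_const_nhds)

theorem restrict_eq_zero_iff [FiniteDimensional ℝ E] (Ω : Opens E) (u : 𝓢'(E, ℂ)) :
    restrict Ω u = 0 ↔ Distribution.IsVanishingOn u (Ω : Set E) := by
  refine ⟨fun h => isVanishingOn_of_forall_hasCompactSupport fun φ hc hs => ?_, fun h => ?_⟩
  · -- The test functions on `Ω` are real, so real and imaginary parts are treated separately.
    have key : ∀ L : ℂ →L[ℝ] ℝ, ∃ ψ : 𝓓(Ω, ℝ), ∀ x, ψ x = L (φ x) := fun L =>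
      ⟨⟨fun x => L (φ x), L.contDiff.comp (φ.smooth ⊤), hc.comp_left (map_zero L),
        (closure_mono (Function.support_comp_subset (map_zero L) φ)).trans hs⟩, fun _ => rfl⟩
    obtain ⟨ψ₁, h₁⟩ := key Complex.reCLM
    obtain ⟨ψ₂, h₂⟩ := key Complex.imCLM
    have hφ : φ = testToSchwartz Ω ψ₁ + Complex.I • testToSchwartz Ω ψ₂ := by
      ext x
      simp [h₁, h₂, mul_comm Complex.I]
    have e₁ : u (testToSchwartz Ω ψ₁) = 0 := congrArg (fun f : 𝓓'(Ω, ℂ) => f ψ₁) h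
    have e₂ : u (testToSchwartz Ω ψ₂) = 0 := congrArg (fun f : 𝓓'(Ω, ℂ) => f ψ₂) h
    rw [hφ, map_add, map_smul, e₁, e₂]
    simp
  · ext φ
    refine h _ ?_
    exact (closure_mono (Function.support_comp_subset Complex.ofReal_zero φ)).trans
      φ.tsupport_subset

theorem restrict_eq_restrict_iff [FiniteDimensional ℝ E] (Ω : Opens E) (u v : 𝓢'(E, ℂ)) :
    restrict Ω u = restrict Ω v ↔ Distribution.IsVanishingOn (u - v : 𝓢'(E, ℂ)) (Ω : Set E) := by
  have : restrict Ω (u - v) = restrict Ω u - restrict Ω v := by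
    ext φ
    rfl
  rw [← restrict_eq_zero_iff, this, sub_eq_zero]

/-- The support of `u` is the complement of the largest open set on which `u` vanishes; a partition
of unity shows that `u` vanishes on a union of open sets if it vanishes on each of them. -/
theorem isVanishingOn_compl_dsupport [FiniteDimensional ℝ E] (u : 𝓢'(E, ℂ)) :
    Distribution.IsVanishingOn u (Distribution.dsupport u)ᶜ := by
  refine isVanishingOn_of_forall_hasCompactSupport fun φ hc hs => ?_
  let U : {a : Set E // Distribution.IsVanishingOn u a ∧ IsOpen a} → Set E := fun a => a
  have hcover : tsupport φ ⊆ ⋃ i, U i := by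
    refine hs.trans ?_
    rw [Distribution.dsupport_compl_eq, Set.sUnion_eq_iUnion]
    exact subset_rfl
  obtain ⟨ρ, hρ⟩ := SmoothPartitionOfUnity.exists_isSubordinate (modelWithCornersSelf ℝ E)
    (isClosed_tsupport φ) U (fun i => i.2.2) hcover
  have hfin := ρ.locallyFinite.finite_nonempty_inter_compact hc.isCompact
  have hcs : ∀ i, HasCompactSupport fun x => (ρ i x : ℂ) * φ x := fun i => hc.mul_left
  have hcd : ∀ i, ContDiff ℝ ∞ fun x => (ρ i x : ℂ) * φ x := fun i =>
    (Complex.ofRealCLM.contDiff.comp (ρ i).contMDiff.contDiff).mul (φ.smooth ⊤)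
  have hsum : φ = ∑ i ∈ hfin.toFinset, (hcs i).toSchwartzMap (hcd i) := by
    ext x
    rw [sum_apply]
    change φ x = ∑ i ∈ hfin.toFinset, (ρ i x : ℂ) * φ x
    by_cases hx : x ∈ tsupport φ
    · rw [← Finset.sum_mul, ← Complex.ofReal_sum, ρ.sum_finsupport' x hx, Complex.ofReal_one, one_mul]
      intro i hi
      rw [Set.Finite.mem_toFinset]
      exact ⟨x, by simpa using hi, hx⟩
    · simp [image_eq_zero_of_notMem_tsupport hx]
  rw [hsum, map_sum]
  refine Finset.sum_eq_zero fun i _ => i.2.1 _ ((closure_mono ?_).trans (hρ i))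
  intro x hx
  simp only [HasCompactSupport.toSchwartzMap_toFun, Function.mem_support] at hx ⊢
  intro h0
  exact hx (by simp [h0])

theorem dsupport_subset_iff [FiniteDimensional ℝ E] {u : 𝓢'(E, ℂ)} {s : Set E} (hs : IsClosed s) :
    Distribution.dsupport u ⊆ s ↔ Distribution.IsVanishingOn u sᶜ :=
  ⟨fun h => (isVanishingOn_compl_dsupport u).mono (Set.compl_subset_compl.2 h),
    fun h => Set.sInter_subset_of_mem ⟨h, hs⟩⟩

end Cutoff

/-! ### The operators `Op(p)` on supports and Sobolev spaces -/

section Operators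

variable {E : Type*} [NormedAddCommGroup E] [InnerProductSpace ℝ E] [FiniteDimensional ℝ E]
  [MeasurableSpace E] [BorelSpace E]

theorem Op_Op_apply {p q : E → ℂ} (hp : p.HasTemperateGrowth) (hq : q.HasTemperateGrowth)
    (u : 𝓢'(E, ℂ)) : Op q (Op p u) = Op (fun ξ => p ξ * q ξ) u := by
  have hs : (fun ξ : E => (2 * Real.pi) • ξ).HasTemperateGrowth := by fun_prop
  exact TemperedDistribution.fourierMultiplierCLM_fourierMultiplierCLM_apply (hp.comp hs)
    (hq.comp hs) u

/-- The order-reducing operator with symbol `((1 + |ξ'|²)^(1/2) + i ⟨e, ξ⟩)^t` attached to the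
half-space `⟨e, x⟩ ≥ 0`. -/
noncomputable def normalOp (e : E) (t : ℝ) : 𝓢'(E, ℂ) →L[ℂ] 𝓢'(E, ℂ) :=
  Op fun ξ => normalSymbol e ξ ^ (t : ℂ)

theorem normalOp_normalOp_apply (e : E) (s t : ℝ) (u : 𝓢'(E, ℂ)) :
    normalOp e t (normalOp e s u) = normalOp e (s + t) u := by
  rw [normalOp, normalOp, Op_Op_apply (hasTemperateGrowth_normalSymbol_cpow e s)
    (hasTemperateGrowth_normalSymbol_cpow e t)]
  simp_rw [normalSymbol_cpow_mul_cpow]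
  rfl

@[simp]
theorem normalOp_zero (e : E) (u : 𝓢'(E, ℂ)) : normalOp e 0 u = u := by
  simp [normalOp, Op]

@[simp]
theorem normalOp_neg_normalOp_apply (e : E) (t : ℝ) (u : 𝓢'(E, ℂ)) :
    normalOp e (-t) (normalOp e t u) = u := by
  rw [normalOp_normalOp_apply, add_neg_cancel, normalOp_zero]

@[simp]
theorem normalOp_normalOp_neg_apply (e : E) (t : ℝ) (u : 𝓢'(E, ℂ)) :
    normalOp e t (normalOp e (-t) u) = u := by
  rw [normalOp_normalOp_apply, neg_add_cancel, normalOp_zero]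

/-- The factorization `(1 + |ξ|²)^a = ((1 + |ξ'|²)^(1/2) + i ⟨e, ξ⟩)^a
((1 + |ξ'|²)^(1/2) - i ⟨e, ξ⟩)^a` of the symbol of `(1 - Δ)^a`. -/
theorem normalOp_neg_left_normalOp_apply {e : E} (he : ‖e‖ = 1) (a : ℝ) (u : 𝓢'(E, ℂ)) :
    normalOp (-e) a (normalOp e a u) = Op (fun ξ => (((1 + ‖ξ‖ ^ 2) ^ a : ℝ) : ℂ)) u := by
  rw [normalOp, normalOp, Op_Op_apply (hasTemperateGrowth_normalSymbol_cpow e a)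
    (hasTemperateGrowth_normalSymbol_cpow (-e) a)]
  simp_rw [normalSymbol_cpow_mul_neg_left he]

/-- The operators attached to `⟨e, x⟩ ≥ 0` preserve support in this half-space. -/
theorem isVanishingOn_normalOp {e : E} (he : ‖e‖ = 1) (t : ℝ) {u : 𝓢'(E, ℂ)}
    (hu : Distribution.IsVanishingOn u {x | inner ℝ e x < 0}) :
    Distribution.IsVanishingOn (normalOp e t u) {x | inner ℝ e x < 0} := by
  refine isVanishingOn_of_forall_hasCompactSupport fun φ hc hs => ?_
  -- By compactness the test function vanishes near the boundary hyperplane.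
  obtain ⟨c, hc0, hcφ⟩ : ∃ c < 0, ∀ x, c < inner ℝ e x → φ x = 0 := by
    rcases (tsupport φ).eq_empty_or_nonempty with h | h
    · refine ⟨-1, by norm_num, fun x _ => image_eq_zero_of_notMem_tsupport ?_⟩
      simp [h]
    · have hcont : ContinuousOn (fun x : E => inner ℝ e x) (tsupport φ) := by fun_prop
      obtain ⟨y, hy, hmax⟩ := hc.isCompact.exists_isMaxOn h hcont
      exact ⟨inner ℝ e y, hs hy, fun x hx => image_eq_zero_of_notMem_tsupport fun hx' =>
        absurd (hmax hx') (not_le.2 hx)⟩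
  change u (𝓕 (SchwartzMap.smulLeftCLM ℂ
    (fun ξ => normalSymbol e ((2 * Real.pi) • ξ) ^ (t : ℂ)) (𝓕⁻ φ))) = 0
  refine hu _ ?_
  have hclosed : IsClosed {x : E | inner ℝ e x ≤ c} := isClosed_le (by fun_prop) continuous_const
  refine (closure_minimal (fun x hx => ?_) hclosed).trans fun x (hx : _ ≤ c) => hx.trans_lt hc0
  by_contra hxc
  exact hx (fourier_smulLeftCLM_normalSymbol_cpow_eq_zero he hcφ t (not_le.1 hxc))

theorem memSobolev_sub_fourierMultiplierCLM {g : E → ℂ} (hg : g.HasTemperateGrowth) {r C : ℝ}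
    (hC : ∀ ξ, ‖g ξ‖ ≤ C * (1 + ‖ξ‖ ^ 2) ^ (r / 2)) {s : ℝ} {u : 𝓢'(E, ℂ)}
    (hu : TemperedDistribution.MemSobolev s 2 u) :
    TemperedDistribution.MemSobolev (s - r) 2
      (TemperedDistribution.fourierMultiplierCLM ℂ g u) := by
  have hB : (fun ξ : E => (((1 + ‖ξ‖ ^ 2) ^ (-r / 2) : ℝ) : ℂ)).HasTemperateGrowth := by fun_prop
  rw [sub_eq_neg_add, ← TemperedDistribution.memSobolev_besselPotential_iff,
    TemperedDistribution.besselPotential,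
    TemperedDistribution.fourierMultiplierCLM_fourierMultiplierCLM_apply hg hB]
  refine hu.fourierMultiplierCLM_of_bounded (hg.mul hB) ⟨C, fun ξ => ?_⟩
  have hpos : 0 < 1 + ‖ξ‖ ^ 2 := by positivity
  rw [Pi.mul_apply, norm_mul, Complex.norm_real, Real.norm_of_nonneg (by positivity)]
  calc ‖g ξ‖ * (1 + ‖ξ‖ ^ 2) ^ (-r / 2) ≤
        C * (1 + ‖ξ‖ ^ 2) ^ (r / 2) * (1 + ‖ξ‖ ^ 2) ^ (-r / 2) := by
        gcongr
        exact hC ξ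
    _ = C := by
        rw [mul_assoc, ← Real.rpow_add hpos, neg_div, add_neg_cancel, Real.rpow_zero, mul_one]

theorem memSobolev_normalOp {e : E} (he : ‖e‖ = 1) (t : ℝ) {s : ℝ} {u : 𝓢'(E, ℂ)}
    (hu : TemperedDistribution.MemSobolev s 2 u) :
    TemperedDistribution.MemSobolev (s - t) 2 (normalOp e t u) :=
  memSobolev_sub_fourierMultiplierCLM (hasTemperateGrowth_normalSymbol_scaled_cpow e t)
    (norm_normalSymbol_cpow_le he t) hu

/-- The operators attached to the opposite half-space are compatible with restriction to
`⟨e, x⟩ > 0`: the restriction of the image depends on the restriction of `u` only. -/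
theorem restrict_normalOp_neg_left_congr {e : E} (he : ‖e‖ = 1) (t : ℝ) {Ω : Opens E}
    (hΩ : (Ω : Set E) = {x | 0 < inner ℝ e x}) {u v : 𝓢'(E, ℂ)}
    (h : restrict Ω u = restrict Ω v) :
    restrict Ω (normalOp (-e) t u) = restrict Ω (normalOp (-e) t v) := by
  have hΩ' : (Ω : Set E) = {x | inner ℝ (-e) x < 0} := by
    rw [hΩ]
    ext x
    simp
  rw [restrict_eq_restrict_iff, hΩ'] at h ⊢
  rw [← map_sub]
  exact isVanishingOn_normalOp (by rwa [norm_neg]) t h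

end Operators

/-! ### Square integrable functions on the half-space -/

section ExtendByZero

variable {E : Type*} [NormedAddCommGroup E] [InnerProductSpace ℝ E] [FiniteDimensional ℝ E]
  [MeasurableSpace E] [BorelSpace E]

theorem coeFn_extendByZero (Ω : Opens E) (g : Lp ℂ 2 (volume.restrict (Ω : Set E))) :
    extendByZero Ω g =ᵐ[volume] (Ω : Set E).indicator g :=
  MemLp.coeFn_toLp _

theorem restrict_extendByZero (Ω : Opens E) {f : 𝓓'(Ω, ℂ)}
    {g : Lp ℂ 2 (volume.restrict (Ω : Set E))} (h : IsGivenBy f g) :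
    restrict Ω (extendByZero Ω g : 𝓢'(E, ℂ)) = f := by
  ext φ
  rw [h φ, restrict_apply, Lp.toTemperedDistribution_apply,
    ← integral_indicator Ω.isOpen.measurableSet]
  refine integral_congr_ae ?_
  filter_upwards [coeFn_extendByZero Ω g] with x hx
  rw [hx]
  by_cases hxΩ : x ∈ (Ω : Set E)
  · simp [hxΩ]
  · simp [hxΩ]

theorem isVanishingOn_extendByZero (Ω : Opens E) (g : Lp ℂ 2 (volume.restrict (Ω : Set E))) :
    Distribution.IsVanishingOn (extendByZero Ω g : 𝓢'(E, ℂ)) (closure (Ω : Set E))ᶜ := by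
  intro φ hφ
  rw [Lp.toTemperedDistribution_apply]
  refine integral_eq_zero_of_ae ?_
  filter_upwards [coeFn_extendByZero Ω g] with x hx
  rw [hx]
  by_cases hxΩ : x ∈ (Ω : Set E)
  · have : φ x = 0 := image_eq_zero_of_notMem_tsupport fun h => hφ h (subset_closure hxΩ)
    simp [this]
  · simp [hxΩ]

theorem exists_isGivenBy_restrict (Ω : Opens E) (v : Lp ℂ 2 (volume : Measure E)) :
    ∃ g : Lp ℂ 2 (volume.restrict (Ω : Set E)), IsGivenBy (restrict Ω (v : 𝓢'(E, ℂ))) g ∧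
      ∀ᵐ x, x ∈ (Ω : Set E) → g x = v x := by
  have hv : MemLp v 2 (volume.restrict (Ω : Set E)) := (Lp.memLp v).restrict _
  have hae : ∀ᵐ x, x ∈ (Ω : Set E) → hv.toLp v x = v x :=
    (ae_restrict_iff' Ω.isOpen.measurableSet).1 hv.coeFn_toLp
  refine ⟨hv.toLp v, fun φ => ?_, hae⟩
  rw [restrict_apply, Lp.toTemperedDistribution_apply,
    ← integral_indicator Ω.isOpen.measurableSet]
  refine integral_congr_ae ?_
  filter_upwards [hae] with x hx
  by_cases hxΩ : x ∈ (Ω : Set E)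
  · simp [hxΩ, hx hxΩ]
  · have : φ x = 0 := image_eq_zero_of_notMem_tsupport fun h => hxΩ (φ.tsupport_subset h)
    simp [hxΩ, this]

theorem ae_eq_zero_of_isVanishingOn {v : Lp ℂ 2 (volume : Measure E)} {U : Set E} (hU : IsOpen U)
    (h : Distribution.IsVanishingOn (v : 𝓢'(E, ℂ)) U) : ∀ᵐ x, x ∈ U → v x = 0 := by
  refine hU.ae_eq_zero_of_integral_contDiff_smul_eq_zero
    (((Lp.memLp v).locallyIntegrable (by norm_num)).locallyIntegrableOn _) fun ψ hψ hc hs => ?_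
  have hc' : HasCompactSupport (fun x => (ψ x : ℂ)) :=
    hc.comp_left (g := Complex.ofReal) Complex.ofReal_zero
  have h1 := h (hc'.toSchwartzMap (Complex.ofRealCLM.contDiff.comp hψ))
    ((closure_mono (Function.support_comp_subset Complex.ofReal_zero ψ)).trans hs)
  rw [Lp.toTemperedDistribution_apply] at h1
  exact (integral_congr_ae (ae_of_all _ fun x => Complex.real_smul)).trans h1

/-- A square integrable function supported in the closure of a convex open set is the extension by
zero of its restriction, because the boundary of a convex set is a null set. -/
theorem exists_isGivenBy_eq_extendByZero (Ω : Opens E) (hΩ : Convex ℝ (Ω : Set E))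
    (v : Lp ℂ 2 (volume : Measure E))
    (h : Distribution.IsVanishingOn (v : 𝓢'(E, ℂ)) (closure (Ω : Set E))ᶜ) :
    ∃ g : Lp ℂ 2 (volume.restrict (Ω : Set E)), IsGivenBy (restrict Ω (v : 𝓢'(E, ℂ))) g ∧
      v = extendByZero Ω g := by
  obtain ⟨g, hg, hae⟩ := exists_isGivenBy_restrict Ω v
  refine ⟨g, hg, Lp.ext ?_⟩
  have hzero := ae_eq_zero_of_isVanishingOn isClosed_closure.isOpen_compl h
  have hfront : ∀ᵐ x, x ∉ frontier (Ω : Set E) :=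
    measure_eq_zero_iff_ae_notMem.1 (hΩ.addHaar_frontier volume)
  filter_upwards [hae, hzero, hfront, coeFn_extendByZero Ω g] with x h1 h2 h3 h4
  rw [h4]
  by_cases hxΩ : x ∈ (Ω : Set E)
  · simp [hxΩ, h1 hxΩ]
  · rw [Set.indicator_of_notMem hxΩ]
    refine h2 fun hcl => h3 ?_
    rw [Ω.isOpen.frontier_eq]
    exact ⟨hcl, hxΩ⟩

end ExtendByZero

/-! ### The model Dirichlet problem -/

section HalfSpace

variable {m : ℕ}

/-- The inner unit normal of the half-space. -/
noncomputable def lastVec (m : ℕ) : Space m := EuclideanSpace.single (Fin.last m) 1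

theorem norm_lastVec : ‖lastVec m‖ = 1 := by simp [lastVec]

theorem inner_lastVec (ξ : Space m) : inner ℝ (lastVec m) ξ = ξ (Fin.last m) := by
  simp [lastVec, EuclideanSpace.inner_single_left]

theorem normalBracket_lastVec (ξ : Space m) :
    normalBracket (lastVec m) ξ = tangentialBracket ξ := by
  rw [normalBracket, tangentialBracket, inner_lastVec, EuclideanSpace.norm_sq_eq,
    Fin.sum_univ_castSucc]
  simp [lastVec, Fin.castSucc_ne_last]

theorem XiPlus_eq_normalOp (t : ℝ) : XiPlus m t = normalOp (lastVec m) t := by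
  simp only [XiPlus, normalOp, normalSymbol, normalBracket_lastVec, inner_lastVec]

theorem coe_halfSpace : (halfSpace m : Set (Space m)) = {x | 0 < inner ℝ (lastVec m) x} := by
  simp only [inner_lastVec]
  rfl

theorem convex_halfSpace : Convex ℝ (halfSpace m : Set (Space m)) :=
  convex_halfSpace_gt (EuclideanSpace.proj (𝕜 := ℝ) (Fin.last m)).isLinear 0

theorem compl_closure_halfSpace :
    (closure (halfSpace m : Set (Space m)))ᶜ = {x | inner ℝ (lastVec m) x < 0} := by
  have hsurj : Function.Surjective (innerSL ℝ (lastVec m)) := fun r =>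
    ⟨r • lastVec m, by simp [norm_lastVec]⟩
  have h := ((innerSL ℝ (lastVec m)).isOpenMap hsurj).preimage_closure_eq_closure_preimage
    (innerSL ℝ (lastVec m)).continuous (Set.Ioi 0)
  rw [closure_Ioi] at h
  have h2 : (halfSpace m : Set (Space m)) = innerSL ℝ (lastVec m) ⁻¹' Set.Ioi 0 := coe_halfSpace
  rw [h2, ← h]
  ext x
  simp

theorem mem_supportedSobolev_halfSpace {s : ℝ} {u : 𝓢'(Space m, ℂ)} :
    u ∈ supportedSobolev (halfSpace m) s ↔ TemperedDistribution.MemSobolev s 2 u ∧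
      Distribution.IsVanishingOn u {x | inner ℝ (lastVec m) x < 0} := by
  rw [← compl_closure_halfSpace, ← dsupport_subset_iff isClosed_closure]
  rfl

theorem normalOp_mem_supportedSobolev (t : ℝ) {s : ℝ} {u : 𝓢'(Space m, ℂ)}
    (hu : u ∈ supportedSobolev (halfSpace m) s) :
    normalOp (lastVec m) t u ∈ supportedSobolev (halfSpace m) (s - t) := by
  rw [mem_supportedSobolev_halfSpace] at hu ⊢
  exact ⟨memSobolev_normalOp norm_lastVec t hu.1, isVanishingOn_normalOp norm_lastVec t hu.2⟩

theorem extendByZero_mem_supportedSobolev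
    (g : Lp ℂ 2 (volume.restrict (halfSpace m : Set (Space m)))) :
    (extendByZero (halfSpace m) g : 𝓢'(Space m, ℂ)) ∈ supportedSobolev (halfSpace m) 0 :=
  ⟨TemperedDistribution.memSobolev_zero_iff.2 ⟨_, rfl⟩,
    (dsupport_subset_iff isClosed_closure).2 (isVanishingOn_extendByZero _ g)⟩

theorem exists_eq_extendByZero_of_mem_supportedSobolev {v : 𝓢'(Space m, ℂ)}
    (hv : v ∈ supportedSobolev (halfSpace m) 0) :
    ∃ g : Lp ℂ 2 (volume.restrict (halfSpace m : Set (Space m))),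
      IsGivenBy (restrict (halfSpace m) v) g ∧
        v = (extendByZero (halfSpace m) g : 𝓢'(Space m, ℂ)) := by
  obtain ⟨hS, hsupp⟩ := hv
  obtain ⟨v', rfl⟩ := TemperedDistribution.memSobolev_zero_iff.1 hS
  obtain ⟨g, hg, hvg⟩ := exists_isGivenBy_eq_extendByZero (halfSpace m) convex_halfSpace v'
    ((dsupport_subset_iff isClosed_closure).1 hsupp)
  exact ⟨g, hg, congrArg _ hvg⟩

theorem mem_restrictedSobolev_zero_iff (Ω : Opens (Space m)) {f : 𝓓'(Ω, ℂ)} :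
    f ∈ restrictedSobolev Ω 0 ↔
      ∃ g : Lp ℂ 2 (volume.restrict (Ω : Set (Space m))), IsGivenBy f g := by
  constructor
  · rintro ⟨v, hv, rfl⟩
    obtain ⟨v', rfl⟩ := TemperedDistribution.memSobolev_zero_iff.1 hv
    obtain ⟨g, hg, -⟩ := exists_isGivenBy_restrict Ω v'
    exact ⟨g, hg⟩
  · rintro ⟨g, hg⟩
    exact ⟨_, TemperedDistribution.memSobolev_zero_iff.2 ⟨extendByZero Ω g, rfl⟩,
      restrict_extendByZero Ω hg⟩

theorem besselOp_eq (a : ℝ) (u : 𝓢'(Space m, ℂ)) :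
    besselOp m a u = normalOp (-lastVec m) a (normalOp (lastVec m) a u) :=
  (normalOp_neg_left_normalOp_apply norm_lastVec a u).symm

/-- In terms of `v = Ξ₊^a u` the equation `r⁺ (1 - Δ)^a u = r⁺ F` prescribes the restriction
of `v`. -/
theorem restrict_besselOp_eq_iff (a : ℝ) (u F : 𝓢'(Space m, ℂ)) :
    restrict (halfSpace m) (besselOp m a u) = restrict (halfSpace m) F ↔
      restrict (halfSpace m) (normalOp (lastVec m) a u) =
        restrict (halfSpace m) (normalOp (-lastVec m) (-a) F) := by
  rw [besselOp_eq]
  constructor <;> intro h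
  · simpa using restrict_normalOp_neg_left_congr norm_lastVec (-a) coe_halfSpace h
  · simpa using restrict_normalOp_neg_left_congr norm_lastVec a coe_halfSpace h

/-- Elements of order zero supported in the closed half-space are determined by their restrictions,
since the boundary hyperplane is a null set. -/
theorem eq_of_restrict_eq {v w : 𝓢'(Space m, ℂ)} (hv : v ∈ supportedSobolev (halfSpace m) 0)
    (hw : w ∈ supportedSobolev (halfSpace m) 0)
    (h : restrict (halfSpace m) v = restrict (halfSpace m) w) : v = w := by
  rw [mem_supportedSobolev_halfSpace] at hv hw
  obtain ⟨d, hd⟩ := TemperedDistribution.memSobolev_zero_iff.1 (hv.1.sub hw.1)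
  have h1 := (restrict_eq_restrict_iff _ _ _).1 h
  have h2 : Distribution.IsVanishingOn (v - w : 𝓢'(Space m, ℂ))
      (closure (halfSpace m : Set (Space m)))ᶜ := by
    rw [compl_closure_halfSpace]
    intro φ hφ
    rw [_root_.sub_apply, hv.2 φ hφ, hw.2 φ hφ, sub_zero]
  rw [hd] at h1 h2
  have hfront : ∀ᵐ x, x ∉ frontier (halfSpace m : Set (Space m)) :=
    measure_eq_zero_iff_ae_notMem.1 (convex_halfSpace.addHaar_frontier volume)
  have hd0 : d = 0 := by
    refine (Lp.eq_zero_iff_ae_eq_zero).2 ?_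
    filter_upwards [ae_eq_zero_of_isVanishingOn (halfSpace m).isOpen h1,
      ae_eq_zero_of_isVanishingOn isClosed_closure.isOpen_compl h2, hfront] with x e1 e2 e3
    by_cases hx : x ∈ (halfSpace m : Set (Space m))
    · exact e1 hx
    · refine e2 fun hcl => e3 ?_
      rw [(halfSpace m).isOpen.frontier_eq]
      exact ⟨hcl, hx⟩
  rw [hd0, ← Lp.toTemperedDistributionCLM_apply, map_zero] at hd
  exact sub_eq_zero.1 hd

theorem transmissionSpace_subset_supportedSobolev (a t : ℝ) :
    transmissionSpace m a t ⊆ supportedSobolev (halfSpace m) a := by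
  rintro u ⟨-, -, g, -, rfl⟩
  rw [XiPlus_eq_normalOp]
  simpa using normalOp_mem_supportedSobolev (-a) (extendByZero_mem_supportedSobolev g)

/-- Membership in the transmission space is a condition on the restriction of `v = Ξ₊^a u`. -/
theorem mem_transmissionSpace_iff {a t : ℝ} {u : 𝓢'(Space m, ℂ)}
    (hu : u ∈ supportedSobolev (halfSpace m) a) :
    u ∈ transmissionSpace m a t ↔ restrict (halfSpace m) (normalOp (lastVec m) a u) ∈
      restrictedSobolev (halfSpace m) (t - a) := by
  rw [transmissionSpace, XiPlus_eq_normalOp]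
  constructor
  · rintro ⟨f, hf, g, hg, rfl⟩
    rwa [normalOp_normalOp_neg_apply, restrict_extendByZero _ hg]
  · intro h
    have hv := normalOp_mem_supportedSobolev a hu
    rw [sub_self] at hv
    obtain ⟨g, hg, hvg⟩ := exists_eq_extendByZero_of_mem_supportedSobolev hv
    exact ⟨_, h, g, hg, by rw [← hvg, normalOp_neg_normalOp_apply]⟩

theorem restrict_besselOp_mem_restrictedSobolev_iff (a s : ℝ) (u : 𝓢'(Space m, ℂ)) :
    restrict (halfSpace m) (besselOp m a u) ∈ restrictedSobolev (halfSpace m) s ↔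
      restrict (halfSpace m) (normalOp (lastVec m) a u) ∈
        restrictedSobolev (halfSpace m) (s + a) := by
  have hn : ‖-lastVec m‖ = 1 := by rw [norm_neg, norm_lastVec]
  constructor
  · rintro ⟨F, hF, h⟩
    have h1 := memSobolev_normalOp hn (-a) hF
    rw [sub_neg_eq_add] at h1
    exact ⟨_, h1, ((restrict_besselOp_eq_iff a u F).1 h.symm).symm⟩
  · rintro ⟨G, hG, h⟩
    have h1 := memSobolev_normalOp hn a hG
    rw [add_sub_cancel_right] at h1
    refine ⟨_, h1, ((restrict_besselOp_eq_iff a u _).2 ?_).symm⟩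
    rw [normalOp_neg_normalOp_apply, h]

/-- The Dirichlet problem is solved by `u = Ξ₊^(-a) e⁺ r⁺ Ξ₋^(-a) F`, where `r⁺ F` is the datum. -/
theorem existsUnique_isDirichletSolution (a : ℝ) {f : 𝓓'(halfSpace m, ℂ)}
    (hf : f ∈ restrictedSobolev (halfSpace m) (-a)) :
    ∃! u : 𝓢'(Space m, ℂ), IsDirichletSolution a f u := by
  obtain ⟨F, hF, rfl⟩ := hf
  have hw := memSobolev_normalOp (e := -lastVec m) (by rw [norm_neg, norm_lastVec]) (-a) hF
  rw [sub_self] at hw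
  obtain ⟨g, hg⟩ := (mem_restrictedSobolev_zero_iff _).1 (Set.mem_image_of_mem _ hw)
  refine existsUnique_of_exists_of_unique
    ⟨normalOp (lastVec m) (-a) (extendByZero (halfSpace m) g : 𝓢'(Space m, ℂ)), ?_, ?_⟩ ?_
  · simpa using normalOp_mem_supportedSobolev (-a) (extendByZero_mem_supportedSobolev g)
  · rw [restrict_besselOp_eq_iff, normalOp_normalOp_neg_apply, restrict_extendByZero _ hg]
  · rintro u₁ u₂ ⟨h₁, e₁⟩ ⟨h₂, e₂⟩
    have k₁ := normalOp_mem_supportedSobolev a h₁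
    have k₂ := normalOp_mem_supportedSobolev a h₂
    rw [sub_self] at k₁ k₂
    have h := eq_of_restrict_eq k₁ k₂ (((restrict_besselOp_eq_iff a u₁ F).1 e₁).trans
      ((restrict_besselOp_eq_iff a u₂ F).1 e₂).symm)
    rw [← normalOp_neg_normalOp_apply (lastVec m) a u₁, h, normalOp_neg_normalOp_apply]

theorem restrict_besselOp_mem_iff_mem_transmissionSpace {a : ℝ} (s : ℝ) {u : 𝓢'(Space m, ℂ)}
    (hu : u ∈ supportedSobolev (halfSpace m) a) :
    restrict (halfSpace m) (besselOp m a u) ∈ restrictedSobolev (halfSpace m) s ↔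
      u ∈ transmissionSpace m a (s + 2 * a) := by
  rw [mem_transmissionSpace_iff hu, restrict_besselOp_mem_restrictedSobolev_iff,
    show s + 2 * a - a = s + a by ring]

end HalfSpace

end HalfSpaceDirichlet

theorem theorem1p1 (m : ℕ) (a : ℝ) (ha0 : 0 < a) (ha1 : a < 1) :
    (∀ f ∈ restrictedSobolev (halfSpace m) (-a),
      ∃! u : 𝓢'(Space m, ℂ), IsDirichletSolution a f u) ∧
    (∀ s : ℝ, -a ≤ s →
      (∀ (f : 𝓓'(halfSpace m, ℂ)) (u : 𝓢'(Space m, ℂ)), IsDirichletSolution a f u →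
        (f ∈ restrictedSobolev (halfSpace m) s ↔ u ∈ transmissionSpace m a (s + 2 * a))) ∧
      transmissionSpace m a (s + 2 * a) ⊆ supportedSobolev (halfSpace m) a) ∧
    dirichletDomain m a = transmissionSpace m a (2 * a) := by
  refine ⟨fun f hf => existsUnique_isDirichletSolution a hf, fun s _ =>
    ⟨fun f u hu => ?_, transmissionSpace_subset_supportedSobolev a _⟩, ?_⟩
  · rw [← hu.2]
    exact restrict_besselOp_mem_iff_mem_transmissionSpace s hu.1
  · ext u
    have key := fun hu : u ∈ supportedSobolev (halfSpace m) a =>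
      restrict_besselOp_mem_iff_mem_transmissionSpace 0 hu
    simp only [zero_add, mem_restrictedSobolev_zero_iff] at key
    exact ⟨fun h => (key h.1).1 h.2, fun h =>
      have hu := transmissionSpace_subset_supportedSobolev a _ h
      ⟨hu, (key hu).2 h⟩⟩
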